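/- Let $q \in L_1(0,\pi)$ be real-valued, and let each of $f$ and $F$ be either the symbol $\infty$ or a rational Herglotz--Nevanlinna function with real coefficients, i.e. $$f(\lambda) = h_0\lambda + h + \sum_{k=1}^{d} \frac{\delta_k}{h_k-\lambda}, \qquad F(\lambda) = H_0\lambda + H + \sum_{k=1}^{D} \frac{\Delta_k}{H_k-\lambda},$$ with $d, D \ge 0$, $h_0, H_0 \ge 0$, $h, H \in \mathbb{R}$, $\delta_k, \Delta_k > 0$, $h_1 < \dots < h_d$, $H_1 < \dots < H_D$. Let $\mathscr{P}(q,f,F)$ be the boundary value problem $$-y''(x) + q(x)y(x) = \lambda y(x) \quad (0 < x < \pi), \qquad \frac{y'(0)}{y(0)} = -f(\lambda), \qquad \frac{y'(\pi)}{y(\pi)} = F(\lambda),$$ where $y, y'$ are absolutely continuous on $[0,\pi]$, the equation holds almost everywhere, and the first (respectively, second) boundary condition means $y(0)=0$ (respectively, $y(\pi)=0$) if $f=\infty$ or $\lambda$ is a pole of $f$ (respectively, if $F=\infty$ or $\lambda$ is a pole of $F$); otherwise the conditions mean $y'(0)=-f(\lambda)y(0)$ and $y'(\pi)=F(\lambda)y(\pi)$.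 An eigenvalue is a number $\lambda \in \mathbb{C}$ for which there is a solution $y$ that is not identically zero on $[0,\pi]$; such a solution is an eigenfunction. For real $\lambda$, let $\Pi_f(\lambda)$ be the number of $k \in \{1,\dots,d\}$ with $h_k \le \lambda$ (and $\Pi_f := 0$ if $f = \infty$), and define $\Pi_F$ in the same way. Theorem. The eigenvalues of $\mathscr{P}(q,f,F)$ are real and form a strictly increasing infinite sequence $\lambda_0 < \lambda_1 < \lambda_2 < \cdots$, and for every $n \ge 0$ every eigenfunction of $\mathscr{P}(q,f,F)$ corresponding to the eigenvalue $\lambda_n$ has exactly $n - \Pi_f(\lambda_n) - \Pi_F(\lambda_n)$ zeros in the open interval $(0,\pi)$. -/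

import Mathlib

open MeasureTheory Polynomial

namespace SturmLiouville

/-- The data of a rational Herglotz--Nevanlinna function with real coefficients
`f(z) = a z + b + ∑ k, δ k / (p k - z)`, where `a ≥ 0`, `δ k > 0` and `p 0 < p 1 < ...`. -/
structure RationalHerglotz where
  /-- the number of (finite) poles -/
  d : ℕ
  /-- the coefficient of the linear term -/
  a : ℝ
  /-- the constant term -/
  b : ℝ
  /-- the poles, in increasing order -/
  p : Fin d → ℝ
  /-- the weights of the poles -/
  δ : Fin d → ℝ
  a_nonneg : 0 ≤ a
  p_strictMono : StrictMono p
  δ_pos : ∀ k, 0 < δ k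

namespace RationalHerglotz

/-- The value `f(z) = a z + b + ∑ k, δ k / (p k - z)` at a point `z` that is not a pole. -/
noncomputable def value (f : RationalHerglotz) (z : ℂ) : ℂ :=
  f.a * z + f.b + ∑ k, (f.δ k : ℂ) / ((f.p k : ℂ) - z)

/-- The normalizing factor, `1 / a` if `a > 0` and `1` if `a = 0`. -/
noncomputable def scale (f : RationalHerglotz) : ℝ :=
  if 0 < f.a then 1 / f.a else 1

/-- The denominator `f_↓(z) = scale * ∏ k, (p k - z)`. -/
noncomputable def down (f : RationalHerglotz) : ℝ[X] :=
  C f.scale * ∏ k, (C (f.p k) - X)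

/-- The numerator `f_↑`, so that `f = f_↑ / f_↓`; see `aeval_up_div_aeval_down`. -/
noncomputable def up (f : RationalHerglotz) : ℝ[X] :=
  C f.scale * ((C f.a * X + C f.b) * ∏ k, (C (f.p k) - X)
    + ∑ k, C (f.δ k) * ∏ j ∈ Finset.univ.erase k, (C (f.p j) - X))

theorem scale_pos (f : RationalHerglotz) : 0 < f.scale := by
  unfold scale
  split_ifs with h
  · positivity
  · exact one_pos

theorem aeval_up_div_aeval_down (f : RationalHerglotz) (z : ℂ)
    (hz : ∀ k, z ≠ (f.p k : ℂ)) :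
    aeval z f.up / aeval z f.down = f.value z := by
  have hs : (f.scale : ℂ) ≠ 0 := by exact_mod_cast f.scale_pos.ne'
  have hk : ∀ k, (f.p k : ℂ) - z ≠ 0 := fun k => sub_ne_zero.mpr (hz k).symm
  have hP : ∏ k, ((f.p k : ℂ) - z) ≠ 0 := Finset.prod_ne_zero_iff.mpr fun k _ => hk k
  have hsum : ∑ k, (f.δ k : ℂ) * ∏ j ∈ Finset.univ.erase k, ((f.p j : ℂ) - z)
      = (∑ k, (f.δ k : ℂ) / ((f.p k : ℂ) - z)) * ∏ k, ((f.p k : ℂ) - z) := by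
    rw [Finset.sum_mul]
    refine Finset.sum_congr rfl fun k _ => ?_
    rw [← Finset.mul_prod_erase Finset.univ _ (Finset.mem_univ k)]
    field_simp [hk k]
  simp only [up, down, value, map_mul, map_add, map_sum, map_prod, map_sub, aeval_C, aeval_X,
    Complex.coe_algebraMap]
  rw [hsum]
  field_simp

end RationalHerglotz

/-- A boundary coefficient: a rational Herglotz--Nevanlinna function, or the symbol `∞`
that stands for the Dirichlet boundary condition. -/
inductive BoundaryFunction where
  | infinity : BoundaryFunction
  | rational (f : RationalHerglotz) : BoundaryFunction

namespace BoundaryFunction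

/-- The numerator `f_↑`, with `∞_↑ = -1`. -/
noncomputable def up : BoundaryFunction → ℝ[X]
  | infinity => -1
  | rational f => f.up

/-- The denominator `f_↓`, with `∞_↓ = 0`. -/
noncomputable def down : BoundaryFunction → ℝ[X]
  | infinity => 0
  | rational f => f.down

/-- `Π_f(t)`, the number of poles of `f` that do not exceed `t` (zero for `f = ∞`). -/
noncomputable def poleCount : BoundaryFunction → ℝ → ℕ
  | infinity, _ => 0
  | rational f, t => (Finset.univ.filter fun k : Fin f.d => f.p k ≤ t).card

end BoundaryFunction

/-- `y` solves `-y'' + q y = z y` on `[0, π]`, and `y'` is its derivative there (one-sided at the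
endpoints): `y` and `y'` are absolutely continuous and the equation holds almost everywhere. -/
structure IsSolution (q : ℝ → ℝ) (z : ℂ) (y y' : ℝ → ℂ) : Prop where
  hasDeriv : ∀ x ∈ Set.Icc 0 Real.pi, HasDerivWithinAt y (y' x) (Set.Icc 0 Real.pi) x
  absolutelyContinuous : AbsolutelyContinuousOnInterval y' 0 Real.pi
  equation : ∀ᵐ x ∂volume.restrict (Set.Ioo 0 Real.pi),
    ∃ y'' : ℂ, HasDerivAt y' y'' x ∧ -y'' + (q x : ℂ) * y x = z * y x

/-- `y` is an eigenfunction, for the eigenvalue `z`, of the problem `-y'' + q y = z y`,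
`y'(0) / y(0) = -f(z)`, `y'(π) / y(π) = F(z)`. The boundary conditions are read as
`f_↓(z) y'(0) = -f_↑(z) y(0)` and `F_↓(z) y'(π) = F_↑(z) y(π)`; thus `y` vanishes at the endpoint
if the coefficient is `∞` or has a pole at `z`. -/
def IsEigenfunction (q : ℝ → ℝ) (f F : BoundaryFunction) (z : ℂ) (y : ℝ → ℂ) : Prop :=
  ∃ y' : ℝ → ℂ, IsSolution q z y y' ∧
    aeval z f.down * y' 0 = -(aeval z f.up * y 0) ∧
    aeval z F.down * y' Real.pi = aeval z F.up * y Real.pi ∧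
    ∃ x ∈ Set.Icc 0 Real.pi, y x ≠ 0

/-- `z` is an eigenvalue of the problem with potential `q` and boundary coefficients `f`, `F`. -/
def IsEigenvalue (q : ℝ → ℝ) (f F : BoundaryFunction) (z : ℂ) : Prop :=
  ∃ y : ℝ → ℂ, IsEigenfunction q f F z y

end SturmLiouville

/-! The proof is a Prüfer angle argument. Since `q` is only integrable, it is removed from the
equation: with `Q` a primitive of `q`, `Q 0 = 0`, the quasi-derivative `u = y' - Q y` turns the
equation into the system `y' = Q y + u`, `u' = -λ y - Q u - Q² y` with continuous coefficients.
Writing `y = r sin θ`, `u = r cos θ` decouples the angle: `θ' = (cos θ + Q sin θ)² + λ sin² θ`. At a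
multiple of `π` the rate is 1, so `θ` crosses each such level at most once, upwards, and the zeros
of `y` are counted by the levels crossed.

A boundary coefficient `f` is encoded by a continuous nondecreasing angle `α_f(λ)` with `cot α_f =
-f`, lying in `[Π_f π, (Π_f + 1) π)`: each pole lifts it through one more multiple of `π`. The left
condition reads `θ(0) = α_f(λ)` mod `π`, and the right one, with `G = F - Q(π)`, reads `θ(π) +
α_G(λ) ∈ π ℤ`.

Starting from `θ(0) = α_f(λ)`, the function `E(λ) = θ(π) + α_G(λ)` is continuous (Grönwall),
strictly increasing (comparison), positive, below `π` for some `λ` and unbounded above. Hence the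
real eigenvalues are exactly the solutions of `E(λ_n) = (n + 1) π`. Then `θ(π)` lies in `((n - Π_F)
π, (n - Π_F + 1) π]` while `θ(0)` lies in `[Π_f π, (Π_f + 1) π)`, which gives the zero count
(`IsPruferAngle.ncard_zeros`). Nonreal eigenvalues are excluded by the Lagrange identity and the
Herglotz property (`IsEigenfunction.im_eq_zero`). -/

namespace SturmLiouville

open Set Filter Topology
open scoped Real NNReal

/-! ### The Prüfer equation: comparison, existence, continuous dependence -/

/-- A function with `w' = n w + r`, `r ≥ 0`, that starts nonnegative stays nonnegative, and it
returns to zero only if both `w` and `r` vanish in between. -/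
theorem nonneg_of_hasDerivAt_linear {w n r : ℝ → ℝ} {a b : ℝ} (hab : a ≤ b)
    (hn : Continuous n) (hr : ∀ x ∈ Icc a b, 0 ≤ r x)
    (hw : ∀ x ∈ Icc a b, HasDerivAt w (n x * w x + r x) x) (ha : 0 ≤ w a) :
    0 ≤ w b ∧ (w b = 0 → ∀ x ∈ Ioo a b, w x = 0 ∧ r x = 0) := by
  -- Integrating factor: `v = e^{-N} w` has derivative `e^{-N} r ≥ 0`. Being monotone and
  -- nonnegative at `a`, `v` can vanish at `b` only if it vanishes on all of `[a, b]`.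
  set N : ℝ → ℝ := fun x => ∫ t in a..x, n t with hN
  have hNd : ∀ x, HasDerivAt N (n x) x := fun x =>
    intervalIntegral.integral_hasDerivAt_right (hn.intervalIntegrable _ _)
      (hn.stronglyMeasurableAtFilter _ _) hn.continuousAt
  set v : ℝ → ℝ := fun x => Real.exp (-N x) * w x with hv
  have hvd : ∀ x ∈ Icc a b, HasDerivAt v (Real.exp (-N x) * r x) x := by
    intro x hx
    have := ((hNd x).neg.exp).mul (hw x hx)
    refine this.congr_deriv ?_
    rw [Pi.neg_apply]
    ring
  have hmono : MonotoneOn v (Icc a b) := by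
    refine monotoneOn_of_deriv_nonneg (convex_Icc a b)
      (fun x hx => (hvd x hx).continuousAt.continuousWithinAt)
      (fun x hx => (hvd x (interior_subset hx)).differentiableAt.differentiableWithinAt) ?_
    intro x hx
    rw [(hvd x (interior_subset hx)).deriv]
    exact mul_nonneg (Real.exp_pos _).le (hr x (interior_subset hx))
  have hva : 0 ≤ v a := mul_nonneg (Real.exp_pos _).le ha
  have hvab : v a ≤ v b := hmono (left_mem_Icc.2 hab) (right_mem_Icc.2 hab) hab
  refine ⟨by
    have h := hva.trans hvab
    exact (mul_nonneg_iff_of_pos_left (Real.exp_pos _)).1 h, fun hb => ?_⟩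
  have hvb : v b = 0 := by simp [hv, hb]
  have hv0 : ∀ x ∈ Icc a b, v x = 0 := fun x hx => le_antisymm
    (hvb ▸ hmono hx (right_mem_Icc.2 hab) hx.2)
    (hva.trans (hmono (left_mem_Icc.2 hab) hx hx.1))
  have hw0 : ∀ x ∈ Icc a b, w x = 0 := fun x hx =>
    (mul_eq_zero.1 (hv0 x hx)).resolve_left (Real.exp_pos _).ne'
  intro x hx
  refine ⟨hw0 x (Ioo_subset_Icc_self hx), ?_⟩
  have h0 : w =ᶠ[𝓝 x] fun _ => 0 := by
    filter_upwards [Icc_mem_nhds hx.1 hx.2] with t ht using hw0 t ht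
  have h1 := (hw x (Ioo_subset_Icc_self hx)).unique
    ((hasDerivAt_const x (0 : ℝ)).congr_of_eventuallyEq h0)
  simpa [hw0 x (Ioo_subset_Icc_self hx)] using h1

/-- The right-hand side of the Prüfer equation. -/
noncomputable def pruferRate (Q : ℝ → ℝ) (l x t : ℝ) : ℝ :=
  (Real.cos t + Q x * Real.sin t) ^ 2 + l * Real.sin t ^ 2

/-- `θ` is a Prüfer angle on `[0, π]`, for the primitive `Q` of the potential and the spectral
parameter `l`. -/
structure IsPruferAngle (Q : ℝ → ℝ) (l : ℝ) (θ : ℝ → ℝ) : Prop where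
  continuous : Continuous θ
  hasDerivAt : ∀ x ∈ Icc 0 π, HasDerivAt θ (pruferRate Q l x (θ x)) x

theorem pruferRate_of_sin_eq_zero {Q : ℝ → ℝ} {l x t : ℝ} (h : Real.sin t = 0) :
    pruferRate Q l x t = 1 := by
  have := Real.sin_sq_add_cos_sq t
  simp [pruferRate, h] at this ⊢
  simpa using this

/-- The difference of the rates at two angles is a continuous multiple of the difference of
the angles. -/
theorem pruferRate_sub (Q : ℝ → ℝ) (l x s t : ℝ) :
    pruferRate Q l x t - pruferRate Q l x s =
      ((Q x ^ 2 + l - 1) * Real.sin (s + t) + 2 * Q x * Real.cos (s + t)) * Real.sinc (t - s)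
        * (t - s) := by
  have hs : Real.sinc (t - s) * (t - s) = Real.sin (t - s) := by
    by_cases h : t - s = 0
    · simp [h]
    · rw [Real.sinc_of_ne_zero h]; field_simp
  rw [mul_assoc, hs, pruferRate, pruferRate, Real.sin_add, Real.cos_add, Real.sin_sub]
  have h1 := Real.sin_sq_add_cos_sq t
  have h2 := Real.sin_sq_add_cos_sq s
  have h3 : Real.cos t ^ 2 = 1 - Real.sin t ^ 2 := by linarith
  have h4 : Real.cos s ^ 2 = 1 - Real.sin s ^ 2 := by linarith
  ring_nf
  simp only [h3, h4]
  ring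

/-- Comparison of Prüfer angles, strict in the spectral parameter. -/
theorem IsPruferAngle.lt_of_lt {Q : ℝ → ℝ} (hQ : Continuous Q) {l m : ℝ} {θ η : ℝ → ℝ}
    (hθ : IsPruferAngle Q l θ) (hη : IsPruferAngle Q m η) (hlm : l < m) (h0 : θ 0 ≤ η 0) :
    θ π < η π := by
  obtain ⟨h1, h2⟩ := nonneg_of_hasDerivAt_linear (w := fun x => η x - θ x)
    (n := fun x => ((Q x ^ 2 + m - 1) * Real.sin (θ x + η x)
      + 2 * Q x * Real.cos (θ x + η x)) * Real.sinc (η x - θ x))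
    (r := fun x => (m - l) * Real.sin (θ x) ^ 2) Real.pi_pos.le
    (by
      have := hθ.continuous
      have := hη.continuous
      have := Real.continuous_sinc
      fun_prop)
    (fun x _ => mul_nonneg (sub_pos.2 hlm).le (sq_nonneg _))
    (fun x hx => by
      refine ((hη.hasDerivAt x hx).sub (hθ.hasDerivAt x hx)).congr_deriv ?_
      rw [← pruferRate_sub]
      simp only [pruferRate]
      ring)
    (sub_nonneg.2 h0)
  -- Equality at `π` would force `sin θ = 0` on the whole interval; but there `θ' = 1`, so `sin θ`
  -- has derivative `cos θ = ±1`.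
  refine lt_of_le_of_ne (sub_nonneg.1 h1) fun h => ?_
  have hr := fun x hx => (h2 (sub_eq_zero.2 h.symm) x hx).2
  have hs : ∀ x ∈ Ioo 0 π, Real.sin (θ x) = 0 := fun x hx => by
    have := (mul_eq_zero.1 (hr x hx)).resolve_left (sub_pos.2 hlm).ne'
    exact pow_eq_zero_iff two_ne_zero |>.1 this
  have hp : (π / 2 : ℝ) ∈ Ioo 0 π := ⟨by positivity, by linarith [Real.pi_pos]⟩
  have hd := (hθ.hasDerivAt _ (Ioo_subset_Icc_self hp)).sin
  rw [pruferRate_of_sin_eq_zero (hs _ hp)] at hd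
  have he : (fun x => Real.sin (θ x)) =ᶠ[𝓝 (π / 2)] fun _ => 0 := by
    filter_upwards [Ioo_mem_nhds hp.1 hp.2] with t ht using hs t ht
  have hc := hd.unique ((hasDerivAt_const _ (0 : ℝ)).congr_of_eventuallyEq he)
  have := Real.sin_sq_add_cos_sq (θ (π / 2))
  rw [hs _ hp] at this
  simp at hc
  simp [hc] at this

/-- A Prüfer angle crosses multiples of `π` only upwards. -/
theorem IsPruferAngle.int_mul_pi_lt {Q : ℝ → ℝ} (hQ : Continuous Q) {l : ℝ} {θ : ℝ → ℝ}
    (hθ : IsPruferAngle Q l θ) {k : ℤ} {a b : ℝ} (ha : 0 ≤ a) (hab : a < b) (hb : b ≤ π)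
    (h : k * π ≤ θ a) : k * π < θ b := by
  have hsub : Icc a b ⊆ Icc 0 π := Icc_subset_Icc ha hb
  -- Comparison with the constant `k π`, where the rate is 1: the remainder `r = 1` never vanishes,
  -- so the inequality is strict.
  obtain ⟨h1, h2⟩ := nonneg_of_hasDerivAt_linear (w := fun x => θ x - k * π)
    (n := fun x => ((Q x ^ 2 + l - 1) * Real.sin (k * π + θ x)
      + 2 * Q x * Real.cos (k * π + θ x)) * Real.sinc (θ x - k * π))
    (r := fun _ => 1) hab.le
    (by
      have := hθ.continuous
      have := Real.continuous_sinc
      fun_prop)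
    (fun x _ => zero_le_one)
    (fun x hx => by
      refine ((hθ.hasDerivAt x (hsub hx)).sub_const _).congr_deriv ?_
      rw [← pruferRate_sub, pruferRate_of_sin_eq_zero (t := k * π) (Real.sin_int_mul_pi k)]
      ring)
    (sub_nonneg.2 h)
  refine lt_of_le_of_ne (sub_nonneg.1 h1) fun he => ?_
  obtain ⟨c, hc⟩ := nonempty_Ioo.2 hab
  exact one_ne_zero (h2 (sub_eq_zero.2 he.symm) c hc).2

theorem abs_mul_le_of_abs_le_one {a b c : ℝ} (ha : |a| ≤ c) (hb : |b| ≤ 1) : |a * b| ≤ c := by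
  rw [abs_mul]
  exact (mul_le_of_le_one_right (abs_nonneg a) hb).trans ha

theorem abs_pruferRate_le {Q : ℝ → ℝ} {M : ℝ} (hM : ∀ x, |Q x| ≤ M) (l x t : ℝ) :
    |pruferRate Q l x t| ≤ (1 + M) ^ 2 + |l| := by
  have hM0 : 0 ≤ M := (abs_nonneg _).trans (hM 0)
  have h1 : |Real.cos t + Q x * Real.sin t| ≤ 1 + M := by
    refine (abs_add_le _ _).trans (add_le_add (Real.abs_cos_le_one t) ?_)
    exact abs_mul_le_of_abs_le_one (hM x) (Real.abs_sin_le_one t)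
  refine (abs_add_le _ _).trans (add_le_add ?_ ?_)
  · rw [abs_pow]
    gcongr
  · rw [abs_mul, abs_pow]
    exact mul_le_of_le_one_right (abs_nonneg _)
      (pow_le_one₀ (abs_nonneg _) (Real.abs_sin_le_one t))

theorem lipschitzWith_pruferRate {Q : ℝ → ℝ} {M : ℝ} (hM : ∀ x, |Q x| ≤ M) (l x : ℝ) :
    LipschitzWith (Real.toNNReal (M ^ 2 + |l| + 1 + 2 * M)) (pruferRate Q l x) := by
  have hM0 : 0 ≤ M := (abs_nonneg _).trans (hM 0)
  refine LipschitzWith.of_dist_le_mul fun t s => ?_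
  rw [Real.coe_toNNReal _ (by positivity), Real.dist_eq, Real.dist_eq, pruferRate_sub, abs_mul]
  gcongr
  refine abs_mul_le_of_abs_le_one ?_ (Real.abs_sinc_le_one _)
  refine (abs_add_le _ _).trans ?_
  rw [add_assoc _ _ (2 * M), add_comm 1, ← add_assoc]
  have hq : Q x ^ 2 ≤ M ^ 2 := sq_le_sq.2 ((hM x).trans (le_abs_self M))
  have e1 : |(Q x ^ 2 + l - 1) * Real.sin (s + t)| ≤ M ^ 2 + |l| + 1 := by
    refine abs_mul_le_of_abs_le_one ?_ (Real.abs_sin_le_one _)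
    rw [abs_le]
    constructor <;> nlinarith [neg_abs_le l, le_abs_self l, sq_nonneg (Q x), sq_nonneg M]
  have e2 : |2 * Q x * Real.cos (s + t)| ≤ 2 * M := by
    refine abs_mul_le_of_abs_le_one ?_ (Real.abs_cos_le_one _)
    rw [abs_mul, abs_two]
    exact mul_le_mul_of_nonneg_left (hM x) zero_le_two
  linarith

theorem exists_isPruferAngle {Q : ℝ → ℝ} (hQ : Continuous Q) {M : ℝ} (hM : ∀ x, |Q x| ≤ M)
    (l α : ℝ) : ∃ θ, IsPruferAngle Q l θ ∧ θ 0 = α := by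
  have hM0 : 0 ≤ M := (abs_nonneg _).trans (hM 0)
  -- The interval `[-1, 4]` contains `[0, π]` in its interior, so derivatives on `[0, π]` are
  -- two-sided. The rate is globally bounded, so a ball of radius bound times 4, the longest time
  -- from 0, suffices.
  have h0 : (0 : ℝ) ∈ Icc (-1 : ℝ) 4 := by norm_num
  have hL : 0 ≤ (1 + M) ^ 2 + |l| := by positivity
  have hP : IsPicardLindelof (pruferRate Q l) ⟨0, h0⟩ α
      (Real.toNNReal (((1 + M) ^ 2 + |l|) * 4)) 0 (Real.toNNReal ((1 + M) ^ 2 + |l|))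
      (Real.toNNReal (M ^ 2 + |l| + 1 + 2 * M)) :=
    { lipschitzOnWith := fun t _ => (lipschitzWith_pruferRate hM l t).lipschitzOnWith
      continuousOn := fun x _ => by
        unfold pruferRate
        fun_prop
      norm_le := fun t _ x _ => by
        rw [Real.coe_toNNReal _ hL]
        exact abs_pruferRate_le hM l t x
      mul_max_le := by
        rw [Real.coe_toNNReal _ hL, Real.coe_toNNReal _ (by positivity)]
        norm_num }
  obtain ⟨η, hη0, hη⟩ := hP.exists_eq_forall_mem_Icc_hasDerivWithinAt₀
  have h4 : (-1 : ℝ) ≤ 4 := by norm_num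
  have hc : ContinuousOn η (Icc (-1) 4) := fun t ht => (hη t ht).continuousWithinAt
  have heq : ∀ x ∈ Icc (-1 : ℝ) 4, IccExtend h4 ((Icc (-1) 4).domRestrict η) x = η x :=
    fun x hx => by rw [IccExtend_of_mem _ _ hx, domRestrict_apply]
  refine ⟨IccExtend h4 ((Icc (-1) 4).domRestrict η), ⟨hc.domRestrict.Icc_extend', fun x hx => ?_⟩, ?_⟩
  · have hx' : x ∈ Ioo (-1 : ℝ) 4 := ⟨by linarith [hx.1], by linarith [hx.2, Real.pi_lt_four]⟩
    rw [heq x (Ioo_subset_Icc_self hx')]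
    refine ((hη x (Ioo_subset_Icc_self hx')).hasDerivAt
      (Icc_mem_nhds hx'.1 hx'.2)).congr_of_eventuallyEq ?_
    filter_upwards [Icc_mem_nhds hx'.1 hx'.2] with t ht using heq t ht
  · rw [heq 0 h0, hη0]

/-- The Prüfer angle at `π` depends continuously on the spectral parameter and on the initial
angle. -/
theorem continuous_pruferAngle_pi {Q : ℝ → ℝ} {M : ℝ} (hM : ∀ x, |Q x| ≤ M)
    {θ : ℝ → ℝ → ℝ} (hθ : ∀ l, IsPruferAngle Q l (θ l)) (h0 : Continuous fun l => θ l 0) :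
    Continuous fun l => θ l π := by
  have hM0 : 0 ≤ M := (abs_nonneg _).trans (hM 0)
  refine continuous_iff_continuousAt.2 fun m => ?_
  set K : ℝ := M ^ 2 + |m| + 1 + 2 * M with hK
  have hKpos : 0 < K := by positivity
  have hbound : ∀ l, dist (θ l π) (θ m π) ≤
      gronwallBound (dist (θ l 0) (θ m 0)) K (|l - m|) π := by
    intro l
    -- `θ l` solves the equation with parameter `m` up to an error of at most `|l - m|`.
    have := dist_le_of_approx_trajectories_ODE (v := pruferRate Q m) (f := θ l) (g := θ m)
      (a := 0) (b := π) (εf := |l - m|) (εg := 0) (lipschitzWith_pruferRate hM m)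
      (hθ l).continuous.continuousOn
      (fun t ht => ((hθ l).hasDerivAt t (Ico_subset_Icc_self ht)).hasDerivWithinAt)
      (fun t ht => by
        have : pruferRate Q l t (θ l t) - pruferRate Q m t (θ l t)
            = (l - m) * Real.sin (θ l t) ^ 2 := by
          simp only [pruferRate]; ring
        rw [Real.dist_eq, this, abs_mul, abs_pow]
        exact mul_le_of_le_one_right (abs_nonneg _)
          (pow_le_one₀ (abs_nonneg _) (Real.abs_sin_le_one _)))
      (hθ m).continuous.continuousOn
      (fun t ht => ((hθ m).hasDerivAt t (Ico_subset_Icc_self ht)).hasDerivWithinAt)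
      (fun t ht => by rw [dist_self]) le_rfl π (right_mem_Icc.2 Real.pi_pos.le)
    rwa [Real.coe_toNNReal _ hKpos.le, sub_zero, add_zero] at this
  refine tendsto_iff_dist_tendsto_zero.2 (squeeze_zero (fun _ => dist_nonneg) hbound ?_)
  simp only [gronwallBound_of_K_ne_0 hKpos.ne']
  have hcont : Continuous fun l => dist (θ l 0) (θ m 0) * Real.exp (K * π)
      + |l - m| / K * (Real.exp (K * π) - 1) := by fun_prop
  simpa using hcont.tendsto m

/-! ### The Prüfer angle for large positive and negative spectral parameter -/

/-- For `c ≥ 0` the integral is the time an angle with rate `cos² + κ sin²` takes to climb from 0 to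
`c`. For `κ ≥ 1` the integrand is at most 1, and it tends to 0 off the countable zero set of `sin`.
-/
theorem tendsto_integral_inv_cos_sq_add_mul_sin_sq (c : ℝ) :
    Tendsto (fun κ : ℝ => ∫ t in 0..c, (Real.cos t ^ 2 + κ * Real.sin t ^ 2)⁻¹) atTop (𝓝 0) := by
  have hge : ∀ κ : ℝ, 1 ≤ κ → ∀ t, 1 ≤ Real.cos t ^ 2 + κ * Real.sin t ^ 2 := fun κ hκ t => by
    nlinarith [Real.sin_sq_add_cos_sq t, sq_nonneg (Real.sin t)]
  have hlim : Tendsto (fun κ : ℝ => ∫ t in 0..c, (Real.cos t ^ 2 + κ * Real.sin t ^ 2)⁻¹) atTop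
      (𝓝 (∫ _ in 0..c, (0 : ℝ))) := by
    refine intervalIntegral.tendsto_integral_filter_of_dominated_convergence (fun _ => (1 : ℝ))
      ?_ ?_ intervalIntegrable_const ?_
    · filter_upwards [eventually_ge_atTop 1] with κ hκ
      refine Continuous.aestronglyMeasurable (Continuous.inv₀ (by fun_prop) fun t => ?_)
      exact (zero_lt_one.trans_le (hge κ hκ t)).ne'
    · filter_upwards [eventually_ge_atTop 1] with κ hκ
      refine Eventually.of_forall fun t _ => ?_
      rw [norm_inv, Real.norm_of_nonneg (zero_le_one.trans (hge κ hκ t))]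
      exact inv_le_one_of_one_le₀ (hge κ hκ t)
    · have hcount : {t : ℝ | Real.sin t = 0}.Countable := by
        refine (countable_range fun n : ℤ => (n : ℝ) * π).mono fun t ht => ?_
        exact Real.sin_eq_zero_iff.1 ht
      have hae : ∀ᵐ t : ℝ, t ∉ {t : ℝ | Real.sin t = 0} := hcount.ae_notMem volume
      filter_upwards [hae] with t ht _
      have hs : 0 < Real.sin t ^ 2 := by
        have : Real.sin t ≠ 0 := ht
        positivity
      exact (tendsto_atTop_add_const_left _ _ (tendsto_id.atTop_mul_const hs)).inv_tendsto_atTop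
  simpa using hlim

/-- Completing the square, `2 (c + Q s)² - c² + 2 Q² s² = (c + 2 Q s)² ≥ 0`. This gives an
autonomous lower bound for the rate. -/
theorem half_le_pruferRate {Q : ℝ → ℝ} {M : ℝ} (hM : ∀ x, |Q x| ≤ M) (l x t : ℝ) :
    (Real.cos t ^ 2 + 2 * (l - M ^ 2) * Real.sin t ^ 2) / 2 ≤ pruferRate Q l x t := by
  have hq : Q x ^ 2 ≤ M ^ 2 := sq_le_sq.2 ((hM x).trans (le_abs_self M))
  have := mul_le_mul_of_nonneg_right hq (sq_nonneg (Real.sin t))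
  unfold pruferRate
  nlinarith [sq_nonneg (Real.cos t + 2 * (Q x * Real.sin t))]

/-- The Prüfer angle at `π` tends to infinity with the spectral parameter. -/
theorem exists_forall_lt_pruferAngle_pi {Q : ℝ → ℝ} {M : ℝ} (hM : ∀ x, |Q x| ≤ M) (c : ℝ) :
    ∃ l₀, ∀ l, l₀ ≤ l → ∀ θ, IsPruferAngle Q l θ → 0 ≤ θ 0 → c < θ π := by
  obtain ⟨κ₀, hκ₀⟩ := eventually_atTop.1 (((tendsto_order.1
    (tendsto_integral_inv_cos_sq_add_mul_sin_sq c)).2 (π / 2) (by positivity)).and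
    (eventually_ge_atTop 1))
  refine ⟨M ^ 2 + κ₀ / 2, fun l hl θ hθ h0 => ?_⟩
  obtain ⟨hint, hκ⟩ := hκ₀ (2 * (l - M ^ 2)) (by linarith)
  set κ := 2 * (l - M ^ 2) with hκdef
  set w : ℝ → ℝ := fun t => (Real.cos t ^ 2 + κ * Real.sin t ^ 2)⁻¹ with hw
  have hpos : ∀ t, 0 < Real.cos t ^ 2 + κ * Real.sin t ^ 2 := fun t => by
    nlinarith [Real.sin_sq_add_cos_sq t, sq_nonneg (Real.sin t)]
  have hwc : Continuous w := Continuous.inv₀ (by fun_prop) fun t => (hpos t).ne'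
  set H : ℝ → ℝ := fun t => ∫ s in 0..t, w s with hH
  have hHd : ∀ t, HasDerivAt H (w t) t := fun t =>
    intervalIntegral.integral_hasDerivAt_right (hwc.intervalIntegrable _ _)
      (hwc.stronglyMeasurableAtFilter _ _) hwc.continuousAt
  have hHm : Monotone H := monotone_of_hasDerivAt_nonneg hHd fun t => (inv_pos.2 (hpos t)).le
  by_contra! hc
  -- Separation of variables: the rate is at least half of `1 / w`, so `H ∘ θ` grows at speed at
  -- least `1 / 2` and gains at least `π / 2` over `[0, π]`, more than `H c` allows.
  have hd : ∀ x ∈ Icc 0 π, HasDerivAt (fun x => H (θ x) - x / 2)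
      (w (θ x) * pruferRate Q l x (θ x) - 1 / 2) x := fun x hx =>
    ((hHd (θ x)).comp x (hθ.hasDerivAt x hx)).sub ((hasDerivAt_id x).div_const 2)
  have hmono : MonotoneOn (fun x => H (θ x) - x / 2) (Icc 0 π) := by
    refine monotoneOn_of_deriv_nonneg (convex_Icc _ _)
      (fun x hx => (hd x hx).continuousAt.continuousWithinAt)
      (fun x hx => (hd x (interior_subset hx)).differentiableAt.differentiableWithinAt) ?_
    intro x hx
    rw [(hd x (interior_subset hx)).deriv, sub_nonneg]
    have := mul_le_mul_of_nonneg_left (half_le_pruferRate hM l x (θ x))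
      (inv_pos.2 (hpos (θ x))).le
    rwa [← hκdef, ← mul_div_assoc, inv_mul_cancel₀ (hpos (θ x)).ne'] at this
  have h1 := hmono (left_mem_Icc.2 Real.pi_pos.le) (right_mem_Icc.2 Real.pi_pos.le) Real.pi_pos.le
  have h2 : 0 ≤ H (θ 0) := by simpa [hH] using hHm h0
  have h3 : H (θ π) ≤ H c := hHm hc
  simp only at h1
  have h4 : H c < π / 2 := hint
  linarith

/-- The Prüfer angle at `π` becomes small as the spectral parameter tends to `-∞`, provided that
the initial angle stays below `π`. -/
theorem exists_forall_pruferAngle_pi_le {Q : ℝ → ℝ} {M : ℝ} (hM : ∀ x, |Q x| ≤ M) {ε β : ℝ}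
    (hε : 0 < ε) (hεβ : ε ≤ β) (hβ : β < π) :
    ∃ l₀, ∀ l ≤ l₀, ∀ θ, IsPruferAngle Q l θ → θ 0 ≤ β → θ π ≤ ε := by
  set s := min (Real.sin ε) (Real.sin β) with hs
  have hspos : 0 < s := lt_min (Real.sin_pos_of_pos_of_lt_pi hε (hεβ.trans_lt hβ))
    (Real.sin_pos_of_pos_of_lt_pi (hε.trans_le hεβ) hβ)
  -- The threshold makes `(1 + M)² + l s²` smaller than the slope of the line from `(0, β)` to `(π,
  -- ε)`. This line is a barrier: where `θ` touches it, `θ ∈ [ε, β]`, so `sin θ ≥ s` by concavity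
  -- and `θ` is steeper downwards.
  refine ⟨min 0 (((ε - β) / π - (1 + M) ^ 2) / s ^ 2 - 1), fun l hl θ hθ h0 => ?_⟩
  have hl0 : l ≤ 0 := hl.trans (min_le_left _ _)
  have hl1 : (1 + M) ^ 2 + l * s ^ 2 < (ε - β) / π := by
    have h1 : l < ((ε - β) / π - (1 + M) ^ 2) / s ^ 2 := by
      linarith [hl.trans (min_le_right _ _)]
    rw [lt_div_iff₀ (by positivity)] at h1
    linarith
  have key := image_le_of_deriv_right_lt_deriv_boundary (f := θ) (a := 0) (b := π)
    (B := fun x => β + (ε - β) / π * x) (B' := fun _ => (ε - β) / π)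
    hθ.continuous.continuousOn
    (fun x hx => (hθ.hasDerivAt x (Ico_subset_Icc_self hx)).hasDerivWithinAt) (by simpa using h0)
    (fun x => by simpa using ((hasDerivAt_id x).const_mul ((ε - β) / π)).const_add β)
    (fun x hx hB => by
      have hmem : θ x ∈ Icc ε β := by
        rw [hB]
        have hx1 : 0 ≤ x / π := div_nonneg hx.1 Real.pi_pos.le
        have hx2 : x / π ≤ 1 := (div_le_one Real.pi_pos).2 hx.2.le
        have : (ε - β) / π * x = -((β - ε) * (x / π)) := by ring
        rw [this]
        constructor <;> nlinarith
      have hsin : s ≤ Real.sin (θ x) :=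
        strictConcaveOn_sin_Icc.concaveOn.min_le_of_mem_Icc ⟨hε.le, hεβ.trans hβ.le⟩
          ⟨hε.le.trans hεβ, hβ.le⟩ hmem
      have hsq : s ^ 2 ≤ Real.sin (θ x) ^ 2 := pow_le_pow_left₀ hspos.le hsin 2
      have h1 := (le_abs_self _).trans (abs_pruferRate_le hM 0 x (θ x))
      have h2 : pruferRate Q l x (θ x) = pruferRate Q 0 x (θ x) + l * Real.sin (θ x) ^ 2 := by
        simp [pruferRate]
      rw [abs_zero, add_zero] at h1
      rw [h2]
      linarith [mul_le_mul_of_nonpos_left hsq hl0])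
    (right_mem_Icc.2 Real.pi_pos.le)
  have hp : (ε - β) / π * π = ε - β := div_mul_cancel₀ _ Real.pi_ne_zero
  simp only [hp] at key
  linarith

/-! ### Counting zeros -/

/-- The number of zeros of `sin θ` in `(0, π)`. -/
theorem IsPruferAngle.ncard_zeros {Q : ℝ → ℝ} (hQ : Continuous Q) {l : ℝ} {θ : ℝ → ℝ}
    (hθ : IsPruferAngle Q l θ) {m n : ℤ} (hm : m * π ≤ θ 0) (hm' : θ 0 < (m + 1) * π)
    (hn : n * π < θ π) (hn' : θ π ≤ (n + 1) * π) :
    {x ∈ Ioo 0 π | Real.sin (θ x) = 0}.Finite ∧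
      ({x ∈ Ioo 0 π | Real.sin (θ x) = 0}.ncard : ℤ) = n - m := by
  have hpi := Real.pi_pos
  have hmn : m ≤ n := by
    have h := hθ.int_mul_pi_lt hQ le_rfl hpi le_rfl hm
    have : (m : ℝ) < n + 1 := lt_of_mul_lt_mul_right (h.trans_le hn') hpi.le
    exact Int.lt_add_one_iff.1 (by exact_mod_cast this)
  have huniq : ∀ k : ℤ, ∀ x ∈ Ioo 0 π, ∀ y ∈ Ioo 0 π, θ x = k * π → θ y = k * π → x = y := by
    intro k x hx y hy hxk hyk
    rcases lt_trichotomy x y with h | h | h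
    · exact absurd hyk (hθ.int_mul_pi_lt hQ hx.1.le h hy.2.le hxk.ge).ne'
    · exact h
    · exact absurd hxk (hθ.int_mul_pi_lt hQ hy.1.le h hx.2.le hyk.ge).ne'
  have hex : ∀ k : ℤ, ∃ x, k ∈ Finset.Ioc m n → x ∈ Ioo 0 π ∧ θ x = k * π := by
    intro k
    by_cases hk : k ∈ Finset.Ioc m n
    · rw [Finset.mem_Ioc] at hk
      have h1 : θ 0 < k * π := by
        refine hm'.trans_le (mul_le_mul_of_nonneg_right ?_ hpi.le)
        exact_mod_cast hk.1
      have h2 : k * π < θ π := by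
        refine lt_of_le_of_lt (mul_le_mul_of_nonneg_right ?_ hpi.le) hn
        exact_mod_cast hk.2
      obtain ⟨x, hx, hxk⟩ := intermediate_value_Ioo hpi.le hθ.continuous.continuousOn ⟨h1, h2⟩
      exact ⟨x, fun _ => ⟨hx, hxk⟩⟩
    · exact ⟨0, fun h => absurd h hk⟩
  choose g hg using hex
  -- The levels crossed inside `(0, π)` are `k π` with `m < k ≤ n`: level `m` is already passed at
  -- 0, and level `n + 1` is reached at `π` at the earliest.
  have himage : {x ∈ Ioo 0 π | Real.sin (θ x) = 0} = g '' (Finset.Ioc m n : Set ℤ) := by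
    ext x
    constructor
    · rintro ⟨hx, hsin⟩
      obtain ⟨k, hk⟩ := Real.sin_eq_zero_iff.1 hsin
      have hk1 : m < k := by
        have h := hθ.int_mul_pi_lt hQ le_rfl hx.1 hx.2.le hm
        rw [← hk] at h
        exact_mod_cast lt_of_mul_lt_mul_right h hpi.le
      have hk2 : k ≤ n := by
        have h := hθ.int_mul_pi_lt hQ hx.1.le hx.2 le_rfl hk.le
        have : (k : ℝ) < n + 1 := lt_of_mul_lt_mul_right (h.trans_le hn') hpi.le
        exact Int.lt_add_one_iff.1 (by exact_mod_cast this)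
      have hkm : k ∈ Finset.Ioc m n := Finset.mem_Ioc.2 ⟨hk1, hk2⟩
      exact ⟨k, hkm, huniq k _ (hg k hkm).1 _ hx (hg k hkm).2 hk.symm⟩
    · rintro ⟨k, hk, rfl⟩
      obtain ⟨h1, h2⟩ := hg k hk
      exact ⟨h1, by rw [h2, Real.sin_int_mul_pi]⟩
  have hinj : InjOn g (Finset.Ioc m n : Set ℤ) := by
    intro j hj k hk hjk
    have h := (hg j hj).2
    rw [hjk, (hg k hk).2] at h
    exact_mod_cast (mul_right_cancel₀ hpi.ne' h).symm
  rw [himage]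
  refine ⟨(Finset.finite_toSet _).image g, ?_⟩
  rw [hinj.ncard_image, ncard_coe_finset, Int.card_Ioc]
  omega

/-! ### The boundary angle of a rational Herglotz function -/

namespace RationalHerglotz

/-- The number of poles that do not exceed `t`. -/
noncomputable def count (f : RationalHerglotz) (t : ℝ) : ℕ :=
  (Finset.univ.filter fun k : Fin f.d => f.p k ≤ t).card

/-- The value at a real point that is not a pole. -/
noncomputable def realValue (f : RationalHerglotz) (t : ℝ) : ℝ :=
  f.a * t + f.b + ∑ k, f.δ k / (f.p k - t)

open Classical in
/-- The continuous increasing angle `α` with `cot α = -f`. -/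
noncomputable def angle (f : RationalHerglotz) (t : ℝ) : ℝ :=
  f.count t * π + if ∃ k, f.p k = t then 0 else π / 2 + Real.arctan (f.realValue t)

theorem angle_of_pole {f : RationalHerglotz} {t : ℝ} (h : ∃ k, f.p k = t) :
    f.angle t = f.count t * π := by
  rw [angle, if_pos h, add_zero]

theorem angle_of_not_pole {f : RationalHerglotz} {t : ℝ} (h : ¬∃ k, f.p k = t) :
    f.angle t = f.count t * π + (π / 2 + Real.arctan (f.realValue t)) := by
  rw [angle, if_neg h]

theorem count_mul_pi_le_angle (f : RationalHerglotz) (t : ℝ) : f.count t * π ≤ f.angle t := by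
  by_cases h : ∃ k, f.p k = t
  · rw [angle_of_pole h]
  · rw [angle_of_not_pole h]
    linarith [Real.neg_pi_div_two_lt_arctan (f.realValue t)]

theorem angle_lt (f : RationalHerglotz) (t : ℝ) : f.angle t < (f.count t + 1) * π := by
  by_cases h : ∃ k, f.p k = t
  · rw [angle_of_pole h]
    linarith [Real.pi_pos]
  · rw [angle_of_not_pole h]
    linarith [Real.arctan_lt_pi_div_two (f.realValue t)]

theorem eval_down (f : RationalHerglotz) (t : ℝ) :
    f.down.eval t = f.scale * ∏ k, (f.p k - t) := by
  simp [down, eval_prod]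

theorem eval_up (f : RationalHerglotz) (t : ℝ) :
    f.up.eval t = f.scale * ((f.a * t + f.b) * ∏ k, (f.p k - t)
      + ∑ k, f.δ k * ∏ j ∈ Finset.univ.erase k, (f.p j - t)) := by
  simp [up, eval_prod, eval_finsetSum]

theorem eval_up_of_not_pole {f : RationalHerglotz} {t : ℝ} (h : ¬∃ k, f.p k = t) :
    f.up.eval t = f.realValue t * f.down.eval t := by
  have hk : ∀ k, f.p k - t ≠ 0 := fun k hk => h ⟨k, sub_eq_zero.1 hk⟩
  have hsum : ∑ k, f.δ k * ∏ j ∈ Finset.univ.erase k, (f.p j - t)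
      = (∑ k, f.δ k / (f.p k - t)) * ∏ k, (f.p k - t) := by
    rw [Finset.sum_mul]
    refine Finset.sum_congr rfl fun k _ => ?_
    rw [← Finset.mul_prod_erase Finset.univ _ (Finset.mem_univ k)]
    field_simp [hk k]
  rw [eval_up, eval_down, hsum, realValue]
  ring

theorem eval_down_ne_zero {f : RationalHerglotz} {t : ℝ} (h : ¬∃ k, f.p k = t) :
    f.down.eval t ≠ 0 := by
  rw [eval_down]
  exact mul_ne_zero f.scale_pos.ne'
    (Finset.prod_ne_zero_iff.2 fun k _ hk => h ⟨k, sub_eq_zero.1 hk⟩)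

theorem eval_down_pole (f : RationalHerglotz) (k : Fin f.d) : f.down.eval (f.p k) = 0 := by
  rw [eval_down, Finset.prod_eq_zero (Finset.mem_univ k) (sub_self _), mul_zero]

theorem eval_up_pole_ne_zero (f : RationalHerglotz) (k : Fin f.d) : f.up.eval (f.p k) ≠ 0 := by
  rw [eval_up, Finset.prod_eq_zero (Finset.mem_univ k) (sub_self _), mul_zero, zero_add,
    Finset.sum_eq_single k]
  · refine mul_ne_zero f.scale_pos.ne' (mul_ne_zero (f.δ_pos k).ne'
      (Finset.prod_ne_zero_iff.2 fun j hj => sub_ne_zero.2 fun h => ?_))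
    exact (Finset.mem_erase.1 hj).1 (f.p_strictMono.injective h)
  · intro j _ hj
    rw [Finset.prod_eq_zero (Finset.mem_erase.2 ⟨hj.symm, Finset.mem_univ k⟩) (sub_self _),
      mul_zero]
  · exact fun h => absurd (Finset.mem_univ k) h

/-- At a pole only one summand of the numerator survives, and it is nonzero. Hence the boundary
condition never degenerates. -/
theorem eval_up_ne_zero_or_eval_down_ne_zero (f : RationalHerglotz) (t : ℝ) :
    f.up.eval t ≠ 0 ∨ f.down.eval t ≠ 0 := by
  by_cases h : ∃ k, f.p k = t
  · obtain ⟨k, rfl⟩ := h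
    exact Or.inl (f.eval_up_pole_ne_zero k)
  · exact Or.inr (eval_down_ne_zero h)

theorem sin_angle_mul_up_add_cos_angle_mul_down (f : RationalHerglotz) (t : ℝ) :
    Real.sin (f.angle t) * f.up.eval t + Real.cos (f.angle t) * f.down.eval t = 0 := by
  by_cases h : ∃ k, f.p k = t
  · rw [angle_of_pole h, Real.sin_nat_mul_pi]
    obtain ⟨k, rfl⟩ := h
    rw [eval_down_pole, zero_mul, mul_zero, add_zero]
  · have h1 : Real.sin (π / 2 + Real.arctan (f.realValue t))
        = Real.cos (Real.arctan (f.realValue t)) := by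
      rw [add_comm, Real.sin_add_pi_div_two]
    have h2 : Real.cos (π / 2 + Real.arctan (f.realValue t))
        = -Real.sin (Real.arctan (f.realValue t)) := by
      rw [add_comm, Real.cos_add_pi_div_two]
    have h3 : f.realValue t * Real.cos (Real.arctan (f.realValue t))
        = Real.sin (Real.arctan (f.realValue t)) := by
      rw [Real.cos_arctan, Real.sin_arctan]
      ring
    rw [angle_of_not_pole h, eval_up_of_not_pole h, Real.sin_add (f.count t * π),
      Real.cos_add (f.count t * π), h1, h2,
      Real.sin_nat_mul_pi, ← h3]
    ring

theorem filter_subset (f : RationalHerglotz) {s t : ℝ} (hst : s ≤ t) :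
    (Finset.univ.filter fun k => f.p k ≤ s) ⊆ Finset.univ.filter fun k => f.p k ≤ t :=
  fun k hk => by
    rw [Finset.mem_filter] at hk ⊢
    exact ⟨hk.1, hk.2.trans hst⟩

/-- If a pole lies in `(s, t]`, the bounds of the angle by the pole count already decide. Otherwise
no `p k - x` changes sign between `s` and `t`, and every summand of `f` is nondecreasing. -/
theorem monotone_angle (f : RationalHerglotz) : Monotone f.angle := by
  intro s t hst
  rcases (Finset.card_le_card (f.filter_subset hst)).lt_or_eq with hlt | heq
  · refine ((f.angle_lt s).le.trans ?_).trans (f.count_mul_pi_le_angle t)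
    refine mul_le_mul_of_nonneg_right ?_ Real.pi_pos.le
    exact_mod_cast hlt
  · have hcount : f.count s = f.count t := heq
    have hset := Finset.eq_of_subset_of_card_le (f.filter_subset hst) heq.ge
    have hp : ∀ k, f.p k ≤ t → f.p k ≤ s := fun k hk => by
      have : k ∈ Finset.univ.filter fun k => f.p k ≤ s := by
        rw [hset]
        exact Finset.mem_filter.2 ⟨Finset.mem_univ k, hk⟩
      exact (Finset.mem_filter.1 this).2
    by_cases hs : ∃ k, f.p k = s
    · rw [angle_of_pole hs, hcount]
      exact f.count_mul_pi_le_angle t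
    · have ht : ¬∃ k, f.p k = t := fun ⟨k, hk⟩ =>
        hs ⟨k, hk.trans (le_antisymm (hk ▸ hp k hk.le) hst)⟩
      rw [angle_of_not_pole hs, angle_of_not_pole ht, hcount]
      have hle : f.realValue s ≤ f.realValue t := by
        refine add_le_add (add_le_add (mul_le_mul_of_nonneg_left hst f.a_nonneg) le_rfl)
          (Finset.sum_le_sum fun k _ => ?_)
        rw [div_eq_mul_inv, div_eq_mul_inv]
        refine mul_le_mul_of_nonneg_left ?_ (f.δ_pos k).le
        rcases le_or_gt (f.p k) t with hk | hk
        · have h1 : f.p k < s := lt_of_le_of_ne (hp k hk) fun h => hs ⟨k, h⟩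
          exact (inv_le_inv_of_neg (by linarith) (by linarith)).2 (by linarith)
        · exact (inv_le_inv₀ (by linarith) (by linarith)).2 (by linarith)
      linarith [Real.arctan_strictMono.monotone hle]

/-- At a pole `f` passes from `+∞` to `-∞`, so the arctangent drops by `π`; the pole count goes up
by one there and compensates. -/
theorem continuous_angle (f : RationalHerglotz) : Continuous f.angle := by
  refine continuous_iff_continuousAt.2 fun t => ?_
  have hright : ∀ᶠ s in 𝓝[>] t, ∀ k, (f.p k ≤ s ↔ f.p k ≤ t) ∧ f.p k ≠ s := by
    refine eventually_all.2 fun k => ?_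
    rcases le_or_gt (f.p k) t with hk | hk
    · filter_upwards [self_mem_nhdsWithin] with s hs
      have hs' : t < s := hs
      exact ⟨⟨fun _ => hk, fun _ => hk.trans hs'.le⟩, (hk.trans_lt hs').ne⟩
    · filter_upwards [nhdsWithin_le_nhds (Iio_mem_nhds hk)] with s hs
      have hs' : s < f.p k := hs
      exact ⟨⟨fun h => absurd h hs'.not_ge, fun h => absurd h hk.not_ge⟩, hs'.ne'⟩
  have hnear : ∀ k, f.p k ≠ t → ∀ᶠ s in 𝓝 t, (f.p k ≤ s ↔ f.p k ≤ t) ∧ f.p k ≠ s := by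
    intro k hk
    rcases hk.lt_or_gt with hk | hk
    · filter_upwards [Ioi_mem_nhds hk] with s hs
      have hs' : f.p k < s := hs
      exact ⟨⟨fun _ => hk.le, fun _ => hs'.le⟩, hs'.ne⟩
    · filter_upwards [Iio_mem_nhds hk] with s hs
      have hs' : s < f.p k := hs
      exact ⟨⟨fun h => absurd h hs'.not_ge, fun h => absurd h hk.not_ge⟩, hs'.ne'⟩
  by_cases ht : ∃ k, f.p k = t
  · obtain ⟨k, rfl⟩ := ht
    have hrest : ContinuousAt (fun s => f.a * s + f.b
        + ∑ j ∈ Finset.univ.erase k, f.δ j / (f.p j - s)) (f.p k) := by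
      refine ContinuousAt.add (by fun_prop) (tendsto_finsetSum _ fun j hj => ?_)
      refine ContinuousAt.div continuousAt_const (by fun_prop) (sub_ne_zero.2 fun h => ?_)
      exact (Finset.mem_erase.1 hj).1 (f.p_strictMono.injective h)
    have hval : f.realValue = fun s => f.δ k * (f.p k - s)⁻¹ + (f.a * s + f.b
        + ∑ j ∈ Finset.univ.erase k, f.δ j / (f.p j - s)) := by
      funext s
      rw [realValue, ← Finset.add_sum_erase _ _ (Finset.mem_univ k)]
      ring
    have hsub : Tendsto (fun s => f.p k - s) (𝓝 (f.p k)) (𝓝 0) := by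
      have : Continuous fun s => f.p k - s := by fun_prop
      simpa using this.tendsto (f.p k)
    refine continuousAt_iff_continuous_left'_right'.2 ⟨?_, ?_⟩
    · have htop : Tendsto f.realValue (𝓝[<] f.p k) atTop := by
        rw [hval]
        refine Tendsto.atTop_add (Tendsto.const_mul_atTop (f.δ_pos k) ?_)
          (hrest.mono_left nhdsWithin_le_nhds)
        refine tendsto_inv_nhdsGT_zero.comp (tendsto_nhdsWithin_iff.2
          ⟨hsub.mono_left nhdsWithin_le_nhds, ?_⟩)
        filter_upwards [self_mem_nhdsWithin] with s hs
        have hs' : s < f.p k := hs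
        exact sub_pos.2 hs'
      have hlim : Tendsto (fun s => f.count (f.p k) * π - π
          + (π / 2 + Real.arctan (f.realValue s))) (𝓝[<] f.p k) (𝓝 (f.angle (f.p k))) := by
        have h := (((Real.tendsto_arctan_atTop.mono_right nhdsWithin_le_nhds).comp
          htop).const_add (π / 2)).const_add (f.count (f.p k) * π - π)
        have e : f.angle (f.p k) = f.count (f.p k) * π - π + (π / 2 + π / 2) := by
          rw [angle_of_pole ⟨k, rfl⟩]
          ring
        rw [e]
        exact h
      refine hlim.congr' ?_
      have hall : ∀ᶠ s in 𝓝[<] f.p k, ∀ j, j ≠ k → (f.p j ≤ s ↔ f.p j ≤ f.p k) ∧ f.p j ≠ s :=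
        eventually_all.2 fun j => by
          by_cases hj : j = k
          · exact Eventually.of_forall fun _ h => absurd hj h
          · filter_upwards [nhdsWithin_le_nhds
              (hnear j fun h => hj (f.p_strictMono.injective h))] with s hs _ using hs
      filter_upwards [hall, self_mem_nhdsWithin] with s hs hsk
      have hsk' : s < f.p k := hsk
      have hnp : ¬∃ j, f.p j = s := by
        rintro ⟨j, hj⟩
        by_cases hjk : j = k
        · subst hjk; exact hsk'.ne' hj
        · exact (hs j hjk).2 hj
      have hfil : (Finset.univ.filter fun j => f.p j ≤ s)
          = (Finset.univ.filter fun j => f.p j ≤ f.p k).erase k := by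
        ext j
        simp only [Finset.mem_filter, Finset.mem_univ, true_and, Finset.mem_erase]
        by_cases hjk : j = k
        · subst hjk; simp [hsk']
        · simp [hjk, (hs j hjk).1]
      have hcount : f.count s + 1 = f.count (f.p k) := by
        rw [count, hfil]
        exact Finset.card_erase_add_one (Finset.mem_filter.2 ⟨Finset.mem_univ k, le_rfl⟩)
      rw [angle_of_not_pole hnp, ← hcount]
      push_cast
      ring
    · have hbot : Tendsto f.realValue (𝓝[>] f.p k) atBot := by
        rw [hval]
        refine Tendsto.atBot_add (Tendsto.const_mul_atBot (f.δ_pos k) ?_)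
          (hrest.mono_left nhdsWithin_le_nhds)
        refine tendsto_inv_nhdsLT_zero.comp (tendsto_nhdsWithin_iff.2
          ⟨hsub.mono_left nhdsWithin_le_nhds, ?_⟩)
        filter_upwards [self_mem_nhdsWithin] with s hs
        have hs' : f.p k < s := hs
        exact sub_neg.2 hs'
      have hlim : Tendsto (fun s => f.count (f.p k) * π
          + (π / 2 + Real.arctan (f.realValue s))) (𝓝[>] f.p k) (𝓝 (f.angle (f.p k))) := by
        have h := (((Real.tendsto_arctan_atBot.mono_right nhdsWithin_le_nhds).comp
          hbot).const_add (π / 2)).const_add (f.count (f.p k) * π)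
        have e : f.angle (f.p k) = f.count (f.p k) * π + (π / 2 + -(π / 2)) := by
          rw [angle_of_pole ⟨k, rfl⟩]
          ring
        rw [e]
        exact h
      refine hlim.congr' ?_
      filter_upwards [hright] with s hs
      have hcount : f.count s = f.count (f.p k) := by simp [count, (hs _).1]
      rw [angle_of_not_pole fun ⟨j, hj⟩ => (hs j).2 hj, hcount]
  · have hval : ContinuousAt f.realValue t := by
      refine ContinuousAt.add (by fun_prop) (tendsto_finsetSum _ fun j _ => ?_)
      exact ContinuousAt.div continuousAt_const (by fun_prop)
        (sub_ne_zero.2 fun h => ht ⟨j, h⟩)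
    have hlim : ContinuousAt (fun s => f.count t * π + (π / 2 + Real.arctan (f.realValue s))) t :=
      ((Real.continuous_arctan.continuousAt.comp hval).const_add _).const_add _
    refine hlim.congr ?_
    filter_upwards [eventually_all.2 fun k => hnear k fun h => ht ⟨k, h⟩] with s hs
    have hcount : f.count s = f.count t := by simp [count, (hs _).1]
    rw [angle_of_not_pole fun ⟨j, hj⟩ => (hs j).2 hj, hcount]

theorem exists_angle_lt_pi (f : RationalHerglotz) : ∃ t, f.angle t < π := by
  obtain ⟨m, hm⟩ := (Set.finite_range f.p).bddBelow
  refine ⟨m - 1, (f.angle_lt _).trans_le ?_⟩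
  have : f.count (m - 1) = 0 := by
    rw [count, Finset.card_eq_zero, Finset.filter_eq_empty_iff]
    intro k _ hk
    linarith [hm (Set.mem_range_self k)]
  simp [this]

/-- The function `f - c`. -/
def subConst (f : RationalHerglotz) (c : ℝ) : RationalHerglotz :=
  { f with b := f.b - c }

theorem up_subConst (f : RationalHerglotz) (c : ℝ) :
    (f.subConst c).up = f.up - C c * f.down := by
  have : (f.subConst c).up = C f.scale * ((C f.a * X + C (f.b - c)) * ∏ k, (C (f.p k) - X)
    + ∑ k, C (f.δ k) * ∏ j ∈ Finset.univ.erase k, (C (f.p j) - X)) := rfl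
  rw [this, up, down, C_sub]
  ring

theorem aeval_down_ne_zero (f : RationalHerglotz) {z : ℂ} (hz : ∀ k, z ≠ (f.p k : ℂ)) :
    aeval z f.down ≠ 0 := by
  simp only [down, map_mul, map_prod, map_sub, aeval_C, aeval_X, Complex.coe_algebraMap]
  exact mul_ne_zero (by exact_mod_cast f.scale_pos.ne')
    (Finset.prod_ne_zero_iff.2 fun k _ => sub_ne_zero.2 (hz k).symm)

/-- The Herglotz property: `Im f(z) = Im z · (a + ∑ δ k / |p k - z|²)`. -/
theorem im_mul_im_value_nonneg (f : RationalHerglotz) (z : ℂ) : 0 ≤ z.im * (f.value z).im := by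
  have h : (f.value z).im = f.a * z.im
      + ∑ k, f.δ k * (z.im / Complex.normSq ((f.p k : ℂ) - z)) := by
    simp only [value, Complex.add_im, Complex.im_sum, Complex.div_im,
      Complex.im_ofReal_mul, Complex.ofReal_im, Complex.ofReal_re, Complex.sub_im, add_zero]
    refine congrArg _ (Finset.sum_congr rfl fun k _ => ?_)
    ring
  rw [h, mul_add, Finset.mul_sum]
  refine add_nonneg ?_ (Finset.sum_nonneg fun k _ => ?_)
  · nlinarith [f.a_nonneg, mul_nonneg f.a_nonneg (mul_self_nonneg z.im)]
  · rw [show z.im * (f.δ k * (z.im / Complex.normSq ((f.p k : ℂ) - z)))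
      = f.δ k * (z.im * z.im / Complex.normSq ((f.p k : ℂ) - z)) by ring]
    exact mul_nonneg (f.δ_pos k).le (div_nonneg (mul_self_nonneg _) (Complex.normSq_nonneg _))

end RationalHerglotz

/-! ### Boundary coefficients including `∞` -/

namespace BoundaryFunction

/-- The continuous increasing angle `α` with `cot α = -f`, zero for `f = ∞`. -/
noncomputable def angle : BoundaryFunction → ℝ → ℝ
  | infinity, _ => 0
  | rational f, t => f.angle t

/-- The function `f - c`. -/
def subConst : BoundaryFunction → ℝ → BoundaryFunction
  | infinity, _ => infinity
  | rational f, c => rational (f.subConst c)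

theorem down_subConst (f : BoundaryFunction) (c : ℝ) : (f.subConst c).down = f.down := by
  cases f <;> rfl

theorem up_subConst (f : BoundaryFunction) (c : ℝ) :
    (f.subConst c).up = f.up - C c * f.down := by
  cases f with
  | infinity => simp [subConst, up, down]
  | rational f => exact f.up_subConst c

theorem poleCount_subConst (f : BoundaryFunction) (c : ℝ) :
    (f.subConst c).poleCount = f.poleCount := by
  cases f <;> rfl

theorem poleCount_mul_pi_le_angle (f : BoundaryFunction) (t : ℝ) :
    f.poleCount t * π ≤ f.angle t := by
  cases f with
  | infinity => simp [poleCount, angle]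
  | rational f => exact f.count_mul_pi_le_angle t

theorem angle_lt (f : BoundaryFunction) (t : ℝ) : f.angle t < (f.poleCount t + 1) * π := by
  cases f with
  | infinity => simp [poleCount, angle, Real.pi_pos]
  | rational f => exact f.angle_lt t

theorem angle_nonneg (f : BoundaryFunction) (t : ℝ) : 0 ≤ f.angle t :=
  (mul_nonneg (Nat.cast_nonneg _) Real.pi_pos.le).trans (f.poleCount_mul_pi_le_angle t)

theorem monotone_angle (f : BoundaryFunction) : Monotone f.angle := by
  cases f with
  | infinity => exact monotone_const
  | rational f => exact f.monotone_angle

theorem continuous_angle (f : BoundaryFunction) : Continuous f.angle := by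
  cases f with
  | infinity => exact continuous_const
  | rational f => exact f.continuous_angle

theorem exists_angle_lt_pi (f : BoundaryFunction) : ∃ t, f.angle t < π := by
  cases f with
  | infinity => exact ⟨0, Real.pi_pos⟩
  | rational f => exact f.exists_angle_lt_pi

theorem eval_up_ne_zero_or_eval_down_ne_zero (f : BoundaryFunction) (t : ℝ) :
    f.up.eval t ≠ 0 ∨ f.down.eval t ≠ 0 := by
  cases f with
  | infinity => simp [up]
  | rational f => exact f.eval_up_ne_zero_or_eval_down_ne_zero t

theorem sin_angle_mul_up_add_cos_angle_mul_down (f : BoundaryFunction) (t : ℝ) :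
    Real.sin (f.angle t) * f.up.eval t + Real.cos (f.angle t) * f.down.eval t = 0 := by
  cases f with
  | infinity => simp [angle, down]
  | rational f => exact f.sin_angle_mul_up_add_cos_angle_mul_down t

/-- At a real point the boundary condition only depends on the angle. -/
theorem aeval_down_mul_eq_iff (f : BoundaryFunction) (t : ℝ) (v w : ℂ) :
    aeval (t : ℂ) f.down * v = aeval (t : ℂ) f.up * w ↔
      Real.sin (f.angle t) * v + Real.cos (f.angle t) * w = 0 := by
  have hd : aeval (t : ℂ) f.down = ((f.down.eval t : ℝ) : ℂ) :=
    aeval_algebraMap_apply_eq_algebraMap_eval t f.down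
  have hu : aeval (t : ℂ) f.up = ((f.up.eval t : ℝ) : ℂ) :=
    aeval_algebraMap_apply_eq_algebraMap_eval t f.up
  rw [hd, hu]
  have h := f.sin_angle_mul_up_add_cos_angle_mul_down t
  have h1 := Real.sin_sq_add_cos_sq (f.angle t)
  have h0 := f.eval_up_ne_zero_or_eval_down_ne_zero t
  generalize f.angle t = α at *
  generalize f.up.eval t = U at *
  generalize f.down.eval t = D at *
  have hc : (Real.sin α : ℂ) * U + Real.cos α * D = 0 := by exact_mod_cast h
  have hc1 : (Real.sin α : ℂ) ^ 2 + (Real.cos α : ℂ) ^ 2 = 1 := by exact_mod_cast h1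
  generalize (Real.sin α : ℂ) = s at *
  generalize (Real.cos α : ℂ) = c at *
  -- Both `(s, c)` and `(D, -U)` are orthogonal to `(U, D) ≠ 0`, hence proportional, so `D v - U w`
  -- and `s v + c w` vanish together.
  constructor
  · intro e
    rcases h0 with h0 | h0
    · have h0' : (U : ℂ) ≠ 0 := by exact_mod_cast h0
      refine (mul_eq_zero.1 (?_ : (U : ℂ) * _ = 0)).resolve_left h0'
      linear_combination v * hc - c * e
    · have h0' : (D : ℂ) ≠ 0 := by exact_mod_cast h0
      refine (mul_eq_zero.1 (?_ : (D : ℂ) * _ = 0)).resolve_left h0'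
      linear_combination w * hc + s * e
  · intro e
    linear_combination (-(v * D - U * w)) * hc1 + (s * D - c * U) * e
      + (c * v - s * w) * hc

theorem im_mul_im_nonneg (f : BoundaryFunction) {z v w : ℂ} (hz : z.im ≠ 0)
    (h : aeval z f.down * v = aeval z f.up * w) :
    0 ≤ z.im * (v * (starRingEnd ℂ) w).im := by
  cases f with
  | infinity =>
    have : w = 0 := by simpa [down, up] using h
    simp [this]
  | rational f =>
    have hk : ∀ k, z ≠ (f.p k : ℂ) := fun k hk => hz (by rw [hk, Complex.ofReal_im])
    have hv : v = f.value z * w := by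
      rw [← f.aeval_up_div_aeval_down z hk, div_mul_eq_mul_div,
        eq_div_iff (f.aeval_down_ne_zero hk), mul_comm]
      exact h
    rw [hv, mul_assoc, Complex.mul_conj, Complex.im_mul_ofReal, ← mul_assoc]
    exact mul_nonneg (f.im_mul_im_value_nonneg z) (Complex.normSq_nonneg w)

end BoundaryFunction

/-! ### The quasi-derivative and the system with continuous coefficients -/

theorem absolutelyContinuousOnInterval_of_hasDerivWithinAt {E : Type*} [NormedAddCommGroup E]
    [NormedSpace ℝ E] {u g : ℝ → E} {a b : ℝ} (hab : a ≤ b) (hg : ContinuousOn g (Icc a b))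
    (hu : ∀ x ∈ Icc a b, HasDerivWithinAt u (g x) (Icc a b) x) :
    AbsolutelyContinuousOnInterval u a b := by
  obtain ⟨c, hc⟩ := isCompact_Icc.exists_bound_of_continuousOn hg
  have h := (convex_Icc a b).lipschitzOnWith_of_nnnorm_hasDerivWithin_le (C := c.toNNReal) hu
    fun x hx => by
      rw [← NNReal.coe_le_coe, coe_nnnorm,
        Real.coe_toNNReal _ ((norm_nonneg _).trans (hc x hx))]
      exact hc x hx
  rw [← uIcc_of_le hab] at h
  exact h.absolutelyContinuousOnInterval

/-- An absolutely continuous function whose derivative agrees almost everywhere with a continuous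
function is continuously differentiable. -/
theorem hasDerivWithinAt_of_ae_hasDerivAt {E : Type*} [NormedAddCommGroup E]
    [NormedSpace ℝ E] [CompleteSpace E] {u g : ℝ → E} {a b : ℝ} (hab : a ≤ b)
    (hg : ContinuousOn g (Icc a b)) (hu : AbsolutelyContinuousOnInterval u a b)
    (hd : ∀ᵐ x, x ∈ Ioo a b → HasDerivAt u (g x) x) :
    ∀ x ∈ Icc a b, HasDerivWithinAt u (g x) (Icc a b) x := by
  set G : ℝ → E := IccExtend hab ((Icc a b).domRestrict g) with hG
  have hGc : Continuous G := hg.domRestrict.Icc_extend'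
  have hGg : ∀ x ∈ Icc a b, G x = g x := fun x hx => by
    rw [hG, IccExtend_of_mem _ _ hx, domRestrict_apply]
  set P : ℝ → E := fun x => ∫ t in a..x, G t with hP
  have hPd : ∀ x, HasDerivAt P (G x) x := fun x =>
    intervalIntegral.integral_hasDerivAt_right (hGc.intervalIntegrable _ _)
      (hGc.stronglyMeasurableAtFilter _ _) hGc.continuousAt
  have hPac := absolutelyContinuousOnInterval_of_hasDerivWithinAt hab hGc.continuousOn
    fun x _ => (hPd x).hasDerivWithinAt
  have hae : ∀ᵐ x, x ∈ uIcc a b → HasDerivAt (u - P) 0 x := by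
    have ha : ∀ᵐ x : ℝ, x ≠ a := by simp [ae_iff]
    have hb : ∀ᵐ x : ℝ, x ≠ b := by simp [ae_iff]
    filter_upwards [hd, ha, hb] with x hx hxa hxb hmem
    rw [uIcc_of_le hab] at hmem
    have h := (hx ⟨lt_of_le_of_ne hmem.1 hxa.symm, lt_of_le_of_ne hmem.2 hxb⟩).sub (hPd x)
    rwa [hGg x hmem, sub_self] at h
  obtain ⟨c, hc⟩ := (hu.sub hPac).const_of_ae_hasDerivAt_zero hae
  rw [uIcc_of_le hab] at hc
  have heq : ∀ x ∈ Icc a b, u x = c + P x := fun x hx => by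
    rw [← hc x hx, Pi.sub_apply, sub_add_cancel]
  intro x hx
  have h := ((hPd x).const_add c).hasDerivWithinAt (s := Icc a b)
  rw [hGg x hx] at h
  exact h.congr heq (heq x hx)

/-- `Q` is a continuous primitive of `q` on `[0, π]`. -/
structure IsPrimitive (q Q : ℝ → ℝ) : Prop where
  continuous : Continuous Q
  zero : Q 0 = 0
  bounded : ∃ M, ∀ x, |Q x| ≤ M
  absolutelyContinuous : AbsolutelyContinuousOnInterval Q 0 π
  ae_hasDerivAt : ∀ᵐ x, x ∈ Ioo 0 π → HasDerivAt Q (q x) x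

theorem exists_isPrimitive {q : ℝ → ℝ} (hq : IntegrableOn q (Ioo 0 π)) :
    ∃ Q, IsPrimitive q Q := by
  -- Cutting `q` off outside `(0, π)` makes the primitive continuous and bounded on the whole line,
  -- as the Prüfer estimates require.
  have hi : Integrable ((Ioo 0 π).indicator q) := hq.integrable_indicator measurableSet_Ioo
  have hii : IntervalIntegrable ((Ioo 0 π).indicator q) volume 0 π := hi.intervalIntegrable
  refine ⟨fun x => ∫ t in 0..x, (Ioo 0 π).indicator q t,
    intervalIntegral.continuous_primitive (fun _ _ => hi.intervalIntegrable) 0,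
    intervalIntegral.integral_same, ⟨∫ t, ‖(Ioo 0 π).indicator q t‖, fun x => ?_⟩,
    hii.absolutelyContinuousOnInterval_intervalIntegral left_mem_uIcc, ?_⟩
  · refine (intervalIntegral.norm_integral_le_integral_norm_uIoc
      (f := (Ioo 0 π).indicator q)).trans ?_
    exact setIntegral_le_integral hi.norm (Eventually.of_forall fun _ => norm_nonneg _)
  · filter_upwards [hii.ae_hasDerivAt_integral] with x hx hmem
    have h := hx (by rw [uIcc_of_le Real.pi_pos.le]; exact Ioo_subset_Icc_self hmem) 0
      left_mem_uIcc
    rwa [indicator_of_mem hmem] at h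

/-- The first-order system with continuous coefficients satisfied by a solution `y` and its
quasi-derivative `u = y' - Q y`. -/
structure IsQuasiSolution (Q : ℝ → ℝ) (z : ℂ) (y u : ℝ → ℂ) : Prop where
  left : ∀ x ∈ Icc 0 π, HasDerivWithinAt y (Q x * y x + u x) (Icc 0 π) x
  right : ∀ x ∈ Icc 0 π,
    HasDerivWithinAt u (-(z * y x) - Q x * u x - Q x ^ 2 * y x) (Icc 0 π) x

theorem AbsolutelyContinuousOnInterval.ofReal_mul {Q : ℝ → ℝ} {y : ℝ → ℂ} {a b : ℝ}
    (hQ : AbsolutelyContinuousOnInterval Q a b) (hy : AbsolutelyContinuousOnInterval y a b) :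
    AbsolutelyContinuousOnInterval (fun x => (Q x : ℂ) * y x) a b := by
  simpa only [Complex.real_smul] using hQ.fun_smul hy

/-- In `(y' - Q y)' = y'' - q y - Q y'` the potential cancels against the equation. The remaining
right-hand side is continuous, so the almost everywhere identity holds everywhere. -/
theorem IsSolution.isQuasiSolution {q Q : ℝ → ℝ} (hQ : IsPrimitive q Q) {z : ℂ} {y y' : ℝ → ℂ}
    (h : IsSolution q z y y') : IsQuasiSolution Q z y fun x => y' x - Q x * y x := by
  have hy : ContinuousOn y (Icc 0 π) := fun x hx => (h.hasDeriv x hx).continuousWithinAt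
  have hy' : ContinuousOn y' (Icc 0 π) := by
    simpa [uIcc_of_le Real.pi_pos.le] using h.absolutelyContinuous.continuousOn
  have hQc : ContinuousOn (fun x => (Q x : ℂ)) (Icc 0 π) :=
    (Complex.continuous_ofReal.comp hQ.continuous).continuousOn
  refine ⟨fun x hx => (h.hasDeriv x hx).congr_deriv (by ring), ?_⟩
  refine hasDerivWithinAt_of_ae_hasDerivAt Real.pi_pos.le ?_ ?_ ?_
  · exact (((continuousOn_const.mul hy).neg).sub (hQc.mul (hy'.sub (hQc.mul hy)))).sub
      ((hQc.pow 2).mul hy)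
  · exact h.absolutelyContinuous.sub (AbsolutelyContinuousOnInterval.ofReal_mul
      hQ.absolutelyContinuous
      (absolutelyContinuousOnInterval_of_hasDerivWithinAt Real.pi_pos.le hy' h.hasDeriv))
  · filter_upwards [hQ.ae_hasDerivAt, (ae_restrict_iff' measurableSet_Ioo).1 h.equation]
      with x hx1 hx2 hx
    obtain ⟨y'', h1, h2⟩ := hx2 hx
    have h3 := (h.hasDeriv x (Ioo_subset_Icc_self hx)).hasDerivAt (Icc_mem_nhds hx.1 hx.2)
    refine (h1.sub ((hx1 hx).ofReal_comp.mul h3)).congr_deriv ?_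
    linear_combination -h2

theorem IsQuasiSolution.isSolution {q Q : ℝ → ℝ} (hQ : IsPrimitive q Q) {z : ℂ} {y u : ℝ → ℂ}
    (h : IsQuasiSolution Q z y u) : IsSolution q z y fun x => Q x * y x + u x := by
  have hy : ContinuousOn y (Icc 0 π) := fun x hx => (h.left x hx).continuousWithinAt
  have hu : ContinuousOn u (Icc 0 π) := fun x hx => (h.right x hx).continuousWithinAt
  have hQc : ContinuousOn (fun x => (Q x : ℂ)) (Icc 0 π) :=
    (Complex.continuous_ofReal.comp hQ.continuous).continuousOn
  refine ⟨h.left, ?_, ?_⟩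
  · refine (AbsolutelyContinuousOnInterval.ofReal_mul hQ.absolutelyContinuous
      (absolutelyContinuousOnInterval_of_hasDerivWithinAt Real.pi_pos.le
        ((hQc.mul hy).add hu) h.left)).add
      (absolutelyContinuousOnInterval_of_hasDerivWithinAt Real.pi_pos.le ?_ h.right)
    exact (((continuousOn_const.mul hy).neg).sub (hQc.mul hu)).sub ((hQc.pow 2).mul hy)
  · rw [ae_restrict_iff' measurableSet_Ioo]
    filter_upwards [hQ.ae_hasDerivAt] with x hx1 hx
    have hn := Icc_mem_nhds hx.1 hx.2
    have h1 := (h.left x (Ioo_subset_Icc_self hx)).hasDerivAt hn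
    have h2 := (h.right x (Ioo_subset_Icc_self hx)).hasDerivAt hn
    exact ⟨_, ((hx1 hx).ofReal_comp.mul h1).add h2, by ring⟩

/-! ### Prüfer formulas for solutions -/

/-- Solutions of a scalar linear equation. -/
theorem eq_mul_exp_of_hasDerivWithinAt {k : ℝ → ℝ} (hk : Continuous k) {w : ℝ → ℂ} {b : ℝ}
    (hw : ∀ x ∈ Icc 0 b, HasDerivWithinAt w (k x * w x) (Icc 0 b) x) :
    ∀ x ∈ Icc 0 b, w x = w 0 * Real.exp (∫ t in 0..x, k t) := by
  set K : ℝ → ℝ := fun x => ∫ t in 0..x, k t with hK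
  have hKd : ∀ x, HasDerivAt K (k x) x := fun x =>
    intervalIntegral.integral_hasDerivAt_right (hk.intervalIntegrable _ _)
      (hk.stronglyMeasurableAtFilter _ _) hk.continuousAt
  set v : ℝ → ℂ := fun x => (Real.exp (-K x) : ℂ) * w x with hv
  have hvd : ∀ x ∈ Icc 0 b, HasDerivWithinAt v 0 (Icc 0 b) x := fun x hx => by
    have h1 : HasDerivAt (fun x => Real.exp (-K x)) (Real.exp (-K x) * -k x) x :=
      (hKd x).neg.exp
    refine (h1.ofReal_comp.hasDerivWithinAt.mul (hw x hx)).congr_deriv ?_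
    push_cast
    ring
  have hconst : ∀ x ∈ Icc 0 b, v x = v 0 :=
    constant_of_has_deriv_right_zero (fun x hx => (hvd x hx).continuousWithinAt) fun x hx =>
      (hvd x (Ico_subset_Icc_self hx)).mono_of_mem_nhdsWithin (Icc_mem_nhdsGE_of_mem hx)
  intro x hx
  have h0 : v 0 = w 0 := by simp [hv, hK]
  have hx' := hconst x hx
  rw [h0] at hx'
  rw [← hx', hv]
  have : (Real.exp (-K x) : ℂ) * Real.exp (K x) = 1 := by
    rw [← Complex.ofReal_mul, ← Real.exp_add, neg_add_cancel, Real.exp_zero, Complex.ofReal_one]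
  linear_combination -w x * this

/-- The logarithmic derivative of the Prüfer radius, with the sign changed. -/
noncomputable def pruferCoeff (Q : ℝ → ℝ) (l : ℝ) (θ : ℝ → ℝ) (x : ℝ) : ℝ :=
  Q x * (Real.cos (θ x) ^ 2 - Real.sin (θ x) ^ 2)
    + (l + Q x ^ 2 - 1) * (Real.sin (θ x) * Real.cos (θ x))

theorem continuous_pruferCoeff {Q : ℝ → ℝ} (hQ : Continuous Q) (l : ℝ) {θ : ℝ → ℝ}
    (hθ : Continuous θ) : Continuous (pruferCoeff Q l θ) := by
  unfold pruferCoeff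
  fun_prop

/-- A solution of the first-order system whose initial vector has the direction of the angle `θ 0`
is given by the Prüfer formulas. -/
theorem IsQuasiSolution.eq_prufer {Q : ℝ → ℝ} (hQ : Continuous Q) {l : ℝ} {θ : ℝ → ℝ}
    (hθ : IsPruferAngle Q l θ) {y u : ℝ → ℂ} (h : IsQuasiSolution Q l y u)
    (h0 : y 0 * Real.cos (θ 0) - u 0 * Real.sin (θ 0) = 0) :
    ∃ c : ℂ, ∃ r : ℝ → ℝ, (∀ x, 0 < r x) ∧ ∀ x ∈ Icc 0 π,
      y x = c * r x * Real.sin (θ x) ∧ u x = c * r x * Real.cos (θ x) := by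
  have hk := continuous_pruferCoeff hQ l hθ.continuous
  have hpyth : ∀ x, (Real.sin (θ x) : ℂ) ^ 2 + (Real.cos (θ x) : ℂ) ^ 2 = 1 := fun x => by
    exact_mod_cast Real.sin_sq_add_cos_sq (θ x)
  have hsd : ∀ x ∈ Icc 0 π, HasDerivWithinAt (fun x => (Real.sin (θ x) : ℂ))
      ((Real.cos (θ x) * pruferRate Q l x (θ x) : ℝ) : ℂ) (Icc 0 π) x := fun x hx =>
    (hθ.hasDerivAt x hx).sin.ofReal_comp.hasDerivWithinAt
  have hcd : ∀ x ∈ Icc 0 π, HasDerivWithinAt (fun x => (Real.cos (θ x) : ℂ))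
      ((-Real.sin (θ x) * pruferRate Q l x (θ x) : ℝ) : ℂ) (Icc 0 π) x := fun x hx =>
    (hθ.hasDerivAt x hx).cos.ofReal_comp.hasDerivWithinAt
  -- The component of `(y, u)` orthogonal to `(sin θ, cos θ)` satisfies a homogeneous scalar
  -- equation, so it stays zero. Given this, the parallel component satisfies one too, and it is the
  -- radius up to a constant.
  have hA := eq_mul_exp_of_hasDerivWithinAt hk (b := π)
    (w := fun x => y x * Real.cos (θ x) - u x * Real.sin (θ x)) fun x hx => by
      refine (((h.left x hx).mul (hcd x hx)).sub ((h.right x hx).mul (hsd x hx))).congr_deriv ?_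
      have hp := hpyth x
      simp only [pruferCoeff, pruferRate, Complex.ofReal_mul, Complex.ofReal_add,
        Complex.ofReal_neg, Complex.ofReal_sub, Complex.ofReal_pow, Complex.ofReal_one]
      generalize (Real.sin (θ x) : ℂ) = s at *
      generalize (Real.cos (θ x) : ℂ) = c at *
      generalize (Q x : ℂ) = Q at *
      linear_combination (-(y x * (Q * c + (l + Q ^ 2) * s)) - u x * (c + Q * s)) * hp
  have hA0 : ∀ x ∈ Icc 0 π, y x * Real.cos (θ x) - u x * Real.sin (θ x) = 0 := fun x hx => by
    rw [hA x hx, h0, zero_mul]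
  have hB := eq_mul_exp_of_hasDerivWithinAt hk.neg (b := π)
    (w := fun x => y x * Real.sin (θ x) + u x * Real.cos (θ x)) fun x hx => by
      refine (((h.left x hx).mul (hsd x hx)).add ((h.right x hx).mul (hcd x hx))).congr_deriv ?_
      have hp := hpyth x
      have hA0x := hA0 x hx
      simp only [pruferCoeff, pruferRate, Pi.neg_apply, Complex.ofReal_mul, Complex.ofReal_add,
        Complex.ofReal_neg, Complex.ofReal_sub, Complex.ofReal_pow, Complex.ofReal_one]
      generalize (Real.sin (θ x) : ℂ) = s at *
      generalize (Real.cos (θ x) : ℂ) = c at *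
      generalize (Q x : ℂ) = Q at *
      linear_combination (4 * Q * s * c + (1 - l - Q ^ 2) * (c ^ 2 - s ^ 2)) * hA0x
        + (y x * (-Q * s + (l + Q ^ 2) * c) + u x * (-s + Q * c)) * hp
  refine ⟨y 0 * Real.sin (θ 0) + u 0 * Real.cos (θ 0),
    fun x => Real.exp (∫ t in 0..x, (-pruferCoeff Q l θ) t), fun x => Real.exp_pos _,
    fun x hx => ?_⟩
  have h1 := hA0 x hx
  have h2 := hpyth x
  have h3 := hB x hx
  rw [← h3]
  constructor
  · linear_combination (Real.cos (θ x)) * h1 - y x * h2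
  · linear_combination -(Real.sin (θ x)) * h1 - u x * h2

/-- The Prüfer formulas define a solution of the first-order system. -/
theorem IsPruferAngle.exists_isQuasiSolution {Q : ℝ → ℝ} (hQ : Continuous Q) {l : ℝ} {θ : ℝ → ℝ}
    (hθ : IsPruferAngle Q l θ) : ∃ r : ℝ → ℝ, (∀ x, 0 < r x) ∧
      IsQuasiSolution Q l (fun x => r x * Real.sin (θ x)) fun x => r x * Real.cos (θ x) := by
  have hk := continuous_pruferCoeff hQ l hθ.continuous
  set K : ℝ → ℝ := fun x => ∫ t in 0..x, pruferCoeff Q l θ t with hK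
  have hKd : ∀ x, HasDerivAt K (pruferCoeff Q l θ x) x := fun x =>
    intervalIntegral.integral_hasDerivAt_right (hk.intervalIntegrable _ _)
      (hk.stronglyMeasurableAtFilter _ _) hk.continuousAt
  have hr : ∀ x, HasDerivAt (fun x => Real.exp (-K x))
      (Real.exp (-K x) * -pruferCoeff Q l θ x) x := fun x => (hKd x).neg.exp
  refine ⟨fun x => Real.exp (-K x), fun x => Real.exp_pos _, fun x hx => ?_, fun x hx => ?_⟩
  · have h := ((hr x).mul (hθ.hasDerivAt x hx).sin).ofReal_comp.hasDerivWithinAt (s := Icc 0 π)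
    simp only [Pi.mul_apply, Complex.ofReal_mul] at h
    refine h.congr_deriv ?_
    have hp := Real.sin_sq_add_cos_sq (θ x)
    simp only [← Complex.ofReal_mul, ← Complex.ofReal_add]
    refine congrArg _ ?_
    simp only [pruferCoeff, pruferRate]
    generalize Real.sin (θ x) = s at *
    generalize Real.cos (θ x) = c at *
    linear_combination Real.exp (-K x) * (Q x * s + c) * hp
  · have h := ((hr x).mul (hθ.hasDerivAt x hx).cos).ofReal_comp.hasDerivWithinAt (s := Icc 0 π)
    simp only [Pi.mul_apply, Complex.ofReal_mul] at h
    refine h.congr_deriv ?_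
    have hp := Real.sin_sq_add_cos_sq (θ x)
    simp only [← Complex.ofReal_mul, ← Complex.ofReal_neg,
      ← Complex.ofReal_sub, ← Complex.ofReal_pow]
    refine congrArg _ ?_
    simp only [pruferCoeff, pruferRate]
    generalize Real.sin (θ x) = s at *
    generalize Real.cos (θ x) = c at *
    linear_combination -Real.exp (-K x) * (Q x * c + (l + Q x ^ 2) * s) * hp

/-! ### Reality of the eigenvalues -/

/-- The Lagrange identity for a solution and its complex conjugate. -/
theorem IsQuasiSolution.hasDerivWithinAt_im {Q : ℝ → ℝ} {z : ℂ} {y u : ℝ → ℂ}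
    (h : IsQuasiSolution Q z y u) {x : ℝ} (hx : x ∈ Icc 0 π) :
    HasDerivWithinAt (fun x => (u x * (starRingEnd ℂ) (y x)).im)
      (-(z.im * Complex.normSq (y x))) (Icc 0 π) x := by
  have hyr := Complex.reCLM.hasFDerivAt.comp_hasDerivWithinAt x (h.left x hx)
  have hyi := Complex.imCLM.hasFDerivAt.comp_hasDerivWithinAt x (h.left x hx)
  have hur := Complex.reCLM.hasFDerivAt.comp_hasDerivWithinAt x (h.right x hx)
  have hui := Complex.imCLM.hasFDerivAt.comp_hasDerivWithinAt x (h.right x hx)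
  refine (((hui.mul hyr).sub (hur.mul hyi)).congr_of_eventuallyEq
    (Eventually.of_forall fun t => ?_) ?_).congr_deriv ?_
  · simp [Complex.mul_im]; ring
  · simp [Complex.mul_im]; ring
  · simp [Complex.normSq_apply, ← Complex.ofReal_pow]
    ring

/-- For nonreal `z`, `V = Im z · Im(u ȳ)` is nonincreasing with derivative `-(Im z)² |y|²`, while
the Herglotz property of `f` and `F` gives `V 0 ≤ 0 ≤ V π`. So `V = 0` and `y = 0`. -/
theorem IsEigenfunction.im_eq_zero {q : ℝ → ℝ} (hq : IntegrableOn q (Ioo 0 π))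
    {f F : BoundaryFunction} {z : ℂ} {y : ℝ → ℂ} (h : IsEigenfunction q f F z y) : z.im = 0 := by
  obtain ⟨Q, hQ⟩ := exists_isPrimitive hq
  obtain ⟨y', hy, h0, h1, x₀, hx₀, hne⟩ := h
  by_contra hz
  have hs := hy.isQuasiSolution hQ
  set V : ℝ → ℝ := fun x => z.im * ((y' x - Q x * y x) * (starRingEnd ℂ) (y x)).im with hV
  have hd : ∀ x ∈ Icc 0 π, HasDerivWithinAt V (-(z.im ^ 2 * Complex.normSq (y x)))
      (Icc 0 π) x := fun x hx =>
    ((hs.hasDerivWithinAt_im hx).const_mul z.im).congr_deriv (by ring)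
  have him : ∀ x, ((y' x - Q x * y x) * (starRingEnd ℂ) (y x)).im
      = (y' x * (starRingEnd ℂ) (y x)).im := fun x => by
    rw [sub_mul, mul_assoc, Complex.mul_conj, ← Complex.ofReal_mul, Complex.sub_im,
      Complex.ofReal_im, sub_zero]
  have hV0 : V 0 ≤ 0 := by
    have := f.im_mul_im_nonneg hz (v := -y' 0) (w := y 0) (by rw [mul_neg, h0, neg_neg])
    rw [neg_mul, Complex.neg_im] at this
    simp only [hV, him]
    linarith
  have hVpi : 0 ≤ V π := by
    simp only [hV, him]
    exact F.im_mul_im_nonneg hz h1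
  have hcont : ContinuousOn V (Icc 0 π) := fun x hx => (hd x hx).continuousWithinAt
  have hdi : ∀ x ∈ Ioo 0 π, HasDerivAt V (-(z.im ^ 2 * Complex.normSq (y x))) x := fun x hx =>
    (hd x (Ioo_subset_Icc_self hx)).hasDerivAt (Icc_mem_nhds hx.1 hx.2)
  have hanti : AntitoneOn V (Icc 0 π) := by
    refine antitoneOn_of_deriv_nonpos (convex_Icc _ _) hcont (fun x hx => ?_) fun x hx => ?_
    · rw [interior_Icc] at hx
      exact (hdi x hx).differentiableAt.differentiableWithinAt
    · rw [interior_Icc] at hx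
      rw [(hdi x hx).deriv, neg_nonpos]
      exact mul_nonneg (sq_nonneg _) (Complex.normSq_nonneg _)
  have hpi := Real.pi_pos.le
  have hzero : ∀ x ∈ Icc 0 π, V x = 0 := fun x hx => le_antisymm
    ((hanti (left_mem_Icc.2 hpi) hx hx.1).trans hV0)
    (hVpi.trans (hanti hx (right_mem_Icc.2 hpi) hx.2))
  have hder := (hd x₀ hx₀).congr (f₁ := fun _ => (0 : ℝ)) (fun x hx => (hzero x hx).symm)
    (hzero x₀ hx₀).symm
  have := (uniqueDiffOn_Icc Real.pi_pos x₀ hx₀).eq_deriv _ hder (hasDerivWithinAt_const x₀ _ 0)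
  rw [neg_eq_zero, mul_eq_zero] at this
  rcases this with h | h
  · exact hz (pow_eq_zero_iff two_ne_zero |>.1 h)
  · exact hne (Complex.normSq_eq_zero.1 h)

/-! ### The eigenvalue condition in terms of angles -/

/-- Since `y' = Q y + u`, passing to the quasi-derivative at `π` replaces `F` by `F - Q(π)`, which
has the same poles. -/
theorem boundary_condition_pi_iff (F : BoundaryFunction) (c t : ℝ) (y u : ℂ) :
    aeval (t : ℂ) F.down * (c * y + u) = aeval (t : ℂ) F.up * y ↔
      Real.sin ((F.subConst c).angle t) * u + Real.cos ((F.subConst c).angle t) * y = 0 := by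
  rw [← BoundaryFunction.aeval_down_mul_eq_iff, F.down_subConst, F.up_subConst, map_sub, map_mul,
    aeval_C, Complex.coe_algebraMap]
  constructor <;> intro h <;> linear_combination h

/-- Every eigenfunction for a real eigenvalue is given by the Prüfer formulas. -/
theorem IsEigenfunction.eq_prufer {q Q : ℝ → ℝ} (hQ : IsPrimitive q Q) {f F : BoundaryFunction}
    {l : ℝ} {y : ℝ → ℂ} (h : IsEigenfunction q f F l y) {θ : ℝ → ℝ} (hθ : IsPruferAngle Q l θ)
    (hθ0 : θ 0 = f.angle l) :
    Real.sin (θ π + (F.subConst (Q π)).angle l) = 0 ∧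
      ∀ x ∈ Icc 0 π, y x = 0 ↔ Real.sin (θ x) = 0 := by
  obtain ⟨y', hy, h0, h1, x₀, hx₀, hne⟩ := h
  have hs := hy.isQuasiSolution hQ
  have hinit : aeval (l : ℂ) f.down * -y' 0 = aeval (l : ℂ) f.up * y 0 := by
    rw [mul_neg, h0, neg_neg]
  rw [f.aeval_down_mul_eq_iff, ← hθ0] at hinit
  obtain ⟨c, r, hr, hyu⟩ := hs.eq_prufer hQ.continuous hθ (by
    rw [hQ.zero, Complex.ofReal_zero]
    linear_combination hinit)
  have hr' : ∀ x, (r x : ℂ) ≠ 0 := fun x => by exact_mod_cast (hr x).ne'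
  have hc : c ≠ 0 := fun hc => hne (by rw [(hyu x₀ hx₀).1, hc, zero_mul, zero_mul])
  refine ⟨?_, fun x hx => ?_⟩
  · obtain ⟨e1, e2⟩ := hyu π (right_mem_Icc.2 Real.pi_pos.le)
    have hb := (boundary_condition_pi_iff F (Q π) l (y π) (y' π - Q π * y π)).1
      (by rw [← h1]; ring)
    rw [e2, e1] at hb
    have hprod : c * r π * ((Real.sin (θ π + (F.subConst (Q π)).angle l) : ℝ) : ℂ) = 0 := by
      rw [Real.sin_add, Complex.ofReal_add, Complex.ofReal_mul, Complex.ofReal_mul]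
      linear_combination hb
    exact_mod_cast (mul_eq_zero.1 hprod).resolve_left (mul_ne_zero hc (hr' π))
  · rw [(hyu x hx).1, mul_eq_zero, or_iff_right (mul_ne_zero hc (hr' x)), Complex.ofReal_eq_zero]

theorem IsPruferAngle.isEigenvalue {q Q : ℝ → ℝ} (hQ : IsPrimitive q Q) {f F : BoundaryFunction}
    {l : ℝ} {θ : ℝ → ℝ} (hθ : IsPruferAngle Q l θ) (hθ0 : θ 0 = f.angle l)
    (h : Real.sin (θ π + (F.subConst (Q π)).angle l) = 0) : IsEigenvalue q f F l := by
  obtain ⟨r, hr, hs⟩ := hθ.exists_isQuasiSolution hQ.continuous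
  refine ⟨_, _, hs.isSolution hQ, ?_, ?_, ?_⟩
  · rw [hQ.zero, Complex.ofReal_zero, zero_mul, zero_add, ← neg_inj, neg_neg, ← mul_neg,
      f.aeval_down_mul_eq_iff, ← hθ0]
    ring
  · rw [boundary_condition_pi_iff]
    have h' : ((Real.sin (θ π + (F.subConst (Q π)).angle l) : ℝ) : ℂ) = 0 := by
      rw [h, Complex.ofReal_zero]
    rw [Real.sin_add, Complex.ofReal_add, Complex.ofReal_mul, Complex.ofReal_mul] at h'
    linear_combination r π * h'
  · by_contra! hall
    have hsin : ∀ x ∈ Ioo 0 π, Real.sin (θ x) = 0 := fun x hx => by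
      have := mul_eq_zero.1 (hall x (Ioo_subset_Icc_self hx))
      exact_mod_cast this.resolve_left (by exact_mod_cast (hr x).ne')
    -- Only finiteness is used; floor, and ceiling minus one, match the opposite half-open
    -- conventions at the two endpoints.
    have hfin := hθ.ncard_zeros hQ.continuous (m := ⌊θ 0 / π⌋) (n := ⌈θ π / π⌉ - 1)
      ((le_div_iff₀ Real.pi_pos).1 (Int.floor_le _))
      ((div_lt_iff₀ Real.pi_pos).1 (Int.lt_floor_add_one _))
      ((lt_div_iff₀ Real.pi_pos).1 (by push_cast; linarith [Int.ceil_lt_add_one (θ π / π)]))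
      ((div_le_iff₀ Real.pi_pos).1 (by push_cast; linarith [Int.le_ceil (θ π / π)]))
    exact Ioo_infinite Real.pi_pos (hfin.1.subset fun x hx => ⟨hx, hsin x hx⟩)

end SturmLiouville

/-! ### The oscillation theorem -/

open SturmLiouville in
theorem mainTheorem5 (q : ℝ → ℝ) (hq : MeasureTheory.IntegrableOn q (Set.Ioo 0 Real.pi))
    (f F : SturmLiouville.BoundaryFunction) :
    ∃ eig : ℕ → ℝ, StrictMono eig ∧
      (∀ z : ℂ, SturmLiouville.IsEigenvalue q f F z ↔ ∃ n : ℕ, z = (eig n : ℂ)) ∧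
      ∀ (n : ℕ) (y : ℝ → ℂ), SturmLiouville.IsEigenfunction q f F (eig n : ℂ) y →
        {x ∈ Set.Ioo 0 Real.pi | y x = 0}.Finite ∧
        ({x ∈ Set.Ioo 0 Real.pi | y x = 0}.ncard : ℤ) =
          (n : ℤ) - (f.poleCount (eig n) : ℤ) - (F.poleCount (eig n) : ℤ) := by
  have hpi := Real.pi_pos
  obtain ⟨Q, hQ⟩ := exists_isPrimitive hq
  obtain ⟨M, hM⟩ := hQ.bounded
  choose θ hθ hθ0 using fun l => exists_isPruferAngle hQ.continuous hM l (f.angle l)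
  set G := F.subConst (Q Real.pi) with hG
  set E : ℝ → ℝ := fun l => θ l Real.pi + G.angle l with hE
  have hEcont : Continuous E := by
    refine (continuous_pruferAngle_pi hM hθ ?_).add G.continuous_angle
    simpa only [hθ0] using f.continuous_angle
  have hEmono : StrictMono E := fun l m hlm =>
    add_lt_add_of_lt_of_le ((hθ l).lt_of_lt hQ.continuous (hθ m) hlm (by
      rw [hθ0, hθ0]
      exact f.monotone_angle hlm.le)) (G.monotone_angle hlm.le)
  have hEpos : ∀ l, 0 < E l := fun l => by
    have := (hθ l).int_mul_pi_lt hQ.continuous (k := 0) le_rfl hpi le_rfl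
      (by rw [hθ0]; simpa using f.angle_nonneg l)
    simp only [Int.cast_zero, zero_mul] at this
    exact add_pos_of_pos_of_nonneg this (G.angle_nonneg l)
  have hElow : ∃ l, E l < Real.pi := by
    obtain ⟨s, hs⟩ := f.exists_angle_lt_pi
    obtain ⟨t, ht⟩ := G.exists_angle_lt_pi
    -- Half the gap: `θ(π) ≤ ε` then leaves `E` below `π`. The bound on the initial angle is the
    -- larger of `f.angle s` and `ε`, both below `π`.
    have hε : 0 < (Real.pi - G.angle t) / 2 := half_pos (sub_pos.2 ht)
    have hε' : (Real.pi - G.angle t) / 2 < Real.pi := by linarith [G.angle_nonneg t]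
    obtain ⟨l₀, hl₀⟩ := exists_forall_pruferAngle_pi_le hM hε (le_max_right (f.angle s) _)
      (max_lt hs hε')
    refine ⟨min l₀ (min s t), ?_⟩
    have h1 := hl₀ _ (min_le_left _ (min s t)) _ (hθ _) (by
      rw [hθ0]
      exact (f.monotone_angle ((min_le_right _ _).trans (min_le_left _ _))).trans
        (le_max_left _ _))
    have h2 := G.monotone_angle ((min_le_right l₀ (min s t)).trans (min_le_right _ _))
    simp only [hE]
    linarith
  have hex : ∀ n : ℕ, ∃ l, E l = (n + 1) * Real.pi := fun n => by
    obtain ⟨l, hl⟩ := hElow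
    obtain ⟨m, hm⟩ := exists_forall_lt_pruferAngle_pi hM ((n + 1) * Real.pi)
    refine mem_range_of_exists_le_of_exists_ge hEcont ⟨l, hl.le.trans ?_⟩ ⟨m, ?_⟩
    · exact le_mul_of_one_le_left hpi.le (by linarith [Nat.cast_nonneg (α := ℝ) n])
    · have := hm m le_rfl _ (hθ m) (by rw [hθ0]; exact f.angle_nonneg m)
      simp only [hE]
      linarith [G.angle_nonneg m]
  choose eig heig using hex
  refine ⟨eig, fun m n hmn => ?_, fun z => ⟨?_, ?_⟩, fun n y hy => ?_⟩
  · rw [← hEmono.lt_iff_lt, heig, heig]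
    refine mul_lt_mul_of_pos_right ?_ hpi
    exact_mod_cast Nat.succ_lt_succ hmn
  · rintro ⟨y, hy⟩
    have hz : z = (z.re : ℂ) := Complex.ext rfl (by simpa using hy.im_eq_zero hq)
    rw [hz] at hy
    obtain ⟨k, hk⟩ := Real.sin_eq_zero_iff.1 (hy.eq_prufer hQ (hθ z.re) (hθ0 z.re)).1
    -- Positivity of `E` leaves only `k ≥ 1`, so numbering from 0 corresponds to the level `(n + 1)
    -- π`.
    have hkpos : 0 < k := by
      have h : 0 < (k : ℝ) * Real.pi := hk ▸ hEpos z.re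
      exact_mod_cast pos_of_mul_pos_left h hpi.le
    obtain ⟨n, hn⟩ := Int.eq_ofNat_of_zero_le (Int.le_sub_one_of_lt hkpos)
    refine ⟨n, hz.trans (congrArg _ (hEmono.injective ?_))⟩
    have hkn : (k : ℝ) = n + 1 := by
      have : k = n + 1 := by omega
      exact_mod_cast this
    rw [heig, ← hkn, hk]
  · rintro ⟨n, rfl⟩
    refine (hθ (eig n)).isEigenvalue hQ (hθ0 _) ?_
    have h : θ (eig n) Real.pi + G.angle (eig n) = ((n + 1 : ℕ) : ℝ) * Real.pi := by
      push_cast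
      exact heig n
    rw [h, Real.sin_nat_mul_pi]
  · have hset : {x ∈ Set.Ioo 0 Real.pi | y x = 0}
        = {x ∈ Set.Ioo 0 Real.pi | Real.sin (θ (eig n) x) = 0} :=
      Set.ext fun x => and_congr_right fun hx =>
        (hy.eq_prufer hQ (hθ _) (hθ0 _)).2 x (Set.Ioo_subset_Icc_self hx)
    have h1 := f.poleCount_mul_pi_le_angle (eig n)
    have h2 := f.angle_lt (eig n)
    have h3 := G.poleCount_mul_pi_le_angle (eig n)
    have h4 := G.angle_lt (eig n)
    have h5 : θ (eig n) Real.pi + G.angle (eig n) = (n + 1) * Real.pi := heig n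
    rw [hG, BoundaryFunction.poleCount_subConst, ← hG] at h3 h4
    rw [← hθ0] at h1 h2
    -- Subtracting `G.angle ∈ [Π_F π, (Π_F + 1) π)` from `(n + 1) π` puts `θ(π)` in the half-open
    -- interval required at the right endpoint.
    have key := (hθ (eig n)).ncard_zeros hQ.continuous (m := f.poleCount (eig n))
      (n := n - F.poleCount (eig n)) (by exact_mod_cast h1) (by exact_mod_cast h2)
      (by push_cast; linarith) (by push_cast; linarith)
    rw [hset]
    refine ⟨key.1, key.2.trans (by ring)⟩
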